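/- Let $N\ge 2$ and $\mathbb R^N_+=\{x=(x',x_N)\in\mathbb R^N: x_N>0\}$. Put $\sigma_N=2\pi^{N/2}/\Gamma(N/2)$ and $C_N^{-1}=\sigma_N\max\{N-2,1\}$. Let $\Gamma^x(y)=C_N|x-y|^{2-N}$ if $N\ge 3$ and $\Gamma^x(y)=-C_2\ln|x-y|$ if $N=2$ be the fundamental solution of $-\Delta$, and let $G^x(y)=\Gamma^x(y)-\Gamma^{\hat x}(y)$, where $\hat x=(x',-x_N)$, be the Green function of $-\Delta$ on $\mathbb R^N_+$. For $x\in\mathbb R^N_+$ and $r>0$ let $\Omega_r(x)=\{y\in\mathbb R^N_+: G^x(y)>1/r\}\cup\{x\}$. Let $u\in C^2(\mathbb R^N_+)$ with $\mu:=-\Delta u\ge 0$ on $\mathbb R^N_+$, and for $x\in\mathbb R^N_+$ set $$l_x:=\frac1{\ln 2}\liminf_{R\to+\infty}\int_{\Omega_{2R}(x)\setminus\Omega_R(x)}\frac{|\nabla G^x(y)|^2}{G^x(y)}\,u(y)\,dy\in[-\infty,+\infty].$$ **(A)** If $x\in\mathbb R^N_+$ and $l_x\in\mathbb R$, then $G^x\mu$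 is integrable on $\mathbb R^N_+$ and $u(x)=l_x+\int_{\mathbb R^N_+}G^x(y)\mu(y)\,dy$. Moreover, if $l(x):=l_x\in\mathbb R$ for every $x\in\mathbb R^N_+$, then: (a) $\inf u=\inf l$ (finite or infinite), and either $u(x)>l(x)$ for all $x\in\mathbb R^N_+$, or $u\equiv l$ and $\mu\equiv 0$; (b) $l$ is harmonic in $\mathbb R^N_+$; (c) if $l_x=c\in\mathbb R$ does not depend on $x$, then $u(x)=c+\int_{\mathbb R^N_+}G^x(y)\mu(y)\,dy$ for every $x\in\mathbb R^N_+$. **(B)** If $u$ is bounded from below, then $l_x\in\mathbb R$ for every $x\in\mathbb R^N_+$, so that the claims in (A) hold. **(C)** If there is a harmonic function $H\in C^2(\mathbb R^N_+)$ such that $u(x)=H(x)+\int_{\mathbb R^N_+}G^x(y)\mu(y)\,dy$ for all $x\in\mathbb R^N_+$ (with $G^x\mu$ integrable on $\mathbb R^N_+$), then $H(x)=l_x$ for every $x\in\mathbb R^N_+$. **(D)** Let $x\in\mathbb R^N_+$ and $c\in\mathbb R$. Then $$\liminf_{R\to+\infty}\int_{\Omega_{2R}(x)\setminus\Omega_R(x)}\frac{|\nabla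 G^x(y)|^2}{G^x(y)}\,|u(y)-c|\,dy=0$$ if and only if $$\liminf_{R\to+\infty}R\int_{\Omega_{2R}(x)\setminus\Omega_R(x)}\frac{1}{|x-y|^{2N}}\,|u(y)-c|\,dy=0.$$ Moreover, if one of these two conditions is satisfied, then $l_x=c$ (in particular $l_x\in\mathbb R$). -/

import Mathlib

open Filter MeasureTheory
open scoped Topology InnerProductSpace Gradient

noncomputable section

namespace HalfSpaceGreen

/-- The constant `C_N`, with `1 / C_N = σ_N * max (N - 2) 1`, where
`σ_N = 2 π ^ (N / 2) / Γ (N / 2)` is the surface measure of the unit sphere of `ℝ^N`. -/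
def fundConst (N : ℕ) : ℝ :=
  1 / (2 * Real.pi ^ ((N : ℝ) / 2) / Real.Gamma ((N : ℝ) / 2) * max ((N : ℝ) - 2) 1)

/-- The fundamental solution `Γ^x(y)` of `-Δ` on `ℝ^N`, for `N ≥ 2` and `y ≠ x`. -/
def fundSol {N : ℕ} (x y : EuclideanSpace ℝ (Fin N)) : ℝ :=
  if N = 2 then -(fundConst N * Real.log ‖x - y‖) else fundConst N / ‖x - y‖ ^ (N - 2)

/-- The open upper half-space of `ℝ^N`, with `N = d + 1`: the last coordinate is positive. -/
def halfSpace (d : ℕ) : Set (EuclideanSpace ℝ (Fin (d + 1))) :=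
  {x | 0 < x (Fin.last d)}

/-- The reflection `(x', x_N) ↦ (x', -x_N)` in the boundary of the half-space. -/
def reflect {d : ℕ} (x : EuclideanSpace ℝ (Fin (d + 1))) : EuclideanSpace ℝ (Fin (d + 1)) :=
  WithLp.toLp 2 (Function.update x.ofLp (Fin.last d) (-x (Fin.last d)))

/-- The Green function `G^x(y)` of `-Δ` on the half-space, for `y ≠ x`. -/
def green {d : ℕ} (x y : EuclideanSpace ℝ (Fin (d + 1))) : ℝ :=
  fundSol x y - fundSol (reflect x) y

/-- The domain `Ω_r(x) = {y | G^x(y) > 1 / r} ∪ {x}`. -/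
def greenBall {d : ℕ} (x : EuclideanSpace ℝ (Fin (d + 1))) (r : ℝ) :
    Set (EuclideanSpace ℝ (Fin (d + 1))) :=
  {y | y ∈ halfSpace d ∧ 1 / r < green x y} ∪ {x}

/-- The standard annulus `Ω_{2R}(x) \ Ω_R(x)`. -/
def greenRing {d : ℕ} (x : EuclideanSpace ℝ (Fin (d + 1))) (R : ℝ) :
    Set (EuclideanSpace ℝ (Fin (d + 1))) :=
  greenBall x (2 * R) \ greenBall x R

/-- The integral of `v` over the standard annulus with the weight `|∇G^x|² / G^x`. -/
def ringIntegral {d : ℕ} (v : EuclideanSpace ℝ (Fin (d + 1)) → ℝ)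
    (x : EuclideanSpace ℝ (Fin (d + 1))) (R : ℝ) : ℝ :=
  ∫ y in greenRing x R, ‖∇ (green x) y‖ ^ 2 / green x y * v y

/-- The extended real number `(1 / ln 2) liminf_{R → ∞}` of the weighted ring integrals of `u`. -/
def ringLiminf {d : ℕ} (u : EuclideanSpace ℝ (Fin (d + 1)) → ℝ)
    (x : EuclideanSpace ℝ (Fin (d + 1))) : EReal :=
  ((1 / Real.log 2 : ℝ) : EReal) *
    liminf (fun R : ℝ => ((ringIntegral u x R : ℝ) : EReal)) atTop

/-- `a = c + ∫ G^x(y) μ(y) dy` over the half-space, the integral being convergent. -/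
def HasGreenRep {d : ℕ} (μ : EuclideanSpace ℝ (Fin (d + 1)) → ℝ)
    (x : EuclideanSpace ℝ (Fin (d + 1))) (a c : ℝ) : Prop :=
  IntegrableOn (fun y => green x y * μ y) (halfSpace d) ∧
    a = c + ∫ y in halfSpace d, green x y * μ y

end HalfSpaceGreen

end

/-!
The ring integral of `u` with the weight `|∇ G|² / G`, `G = green x`, is computed exactly. For a
weight `w` on the levels of `G`, let `Φ` be the second primitive `weightPotential w`, so that
`Φ'' = w`. Since `G` is harmonic off its pole, `Δ (Φ ∘ G) = w(G) |∇ G|²` there, while at the pole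
`Φ ∘ G` behaves like `(∫ w) G` up to a constant. Green's second identity and the equation
`-Δ G = δ_x` then give (`IsGreenLike.representation`)
`∫ w(G) |∇ G|² u = (∫ w) u(x) + ∫ Φ(G) Δ u`.
For `w(t) = 1 / t` on the levels `1 / (2R) < t ≤ 1 / R` this says that the ring integral equals
`ln 2 · u(x) - ∫ Φ_R(G) μ` (`ringIntegral_eq`), where `0 ≤ Φ_R(s) ≤ s ln 2` and
`Φ_R(s) → s ln 2` as `R → ∞`. By dominated convergence and Fatou's lemma, the ring integrals
converge to `ln 2 (u(x) - ∫ G μ)` if `G μ` is integrable and to `-∞` otherwise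
(`tendsto_ringIntegral`). Hence the ring limit is a real number `c` exactly when
`u(x) = c + ∫ G μ` (`ringLiminf_eq_coe_iff`), from which the representation formulas and the
comparison of `u` with `l` follow; a lower bound of `u` bounds the ring integrals from below and
excludes the limit `-∞`.

Harmonicity of `l` (`harmonicOnNhd_of_greenPotential`) comes from the same formula applied to the
fundamental solution on small balls, where it is a mean value formula with a smooth averaging
kernel (`exists_meanValue_kernel`). Near a given point `l` is the Green potential of a density that
vanishes near that point, so `l` inherits the mean value property from the Green functions by
Fubini's theorem. It is therefore smooth, and the error term of the mean value formula forces
`Δ l = 0`.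

The explicit weight `R |x - y|^(-2N)` is comparable with `|∇ G|² / G` on large rings, because
`|∇ G|²` lies between two multiples of `|x - y|^(-2N)` away from the pole
(`exists_norm_gradient_green_sq_le`, `exists_le_norm_gradient_green_sq`).
-/

noncomputable section

namespace HalfSpaceGreen

/-! ### Laplacian calculus and Green's second identity -/

section Calculus

variable {E : Type*} [NormedAddCommGroup E] [InnerProductSpace ℝ E] [FiniteDimensional ℝ E]

theorem laplacian_eq_sum_fderiv_fderiv {ι : Type*} [Fintype ι] (b : OrthonormalBasis ι ℝ E)
    (f : E → ℝ) (x : E) :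
    Laplacian.laplacian f x = ∑ i, fderiv ℝ (fderiv ℝ f) x (b i) (b i) := by
  rw [InnerProductSpace.laplacian_eq_iteratedFDeriv_orthonormalBasis f b]
  simp [iteratedFDeriv_two_apply]

theorem fderiv_fderiv_apply {E : Type*} [NormedAddCommGroup E] [NormedSpace ℝ E] {f : E → ℝ}
    {x : E} (hf : ContDiffAt ℝ 2 f x) (a b : E) :
    fderiv ℝ (fun y => fderiv ℝ f y a) x b = fderiv ℝ (fderiv ℝ f) x b a := by
  have h : DifferentiableAt ℝ (fderiv ℝ f) x :=
    (hf.fderiv_right (m := 1) (by norm_num)).differentiableAt (by norm_num)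
  rw [fderiv_clm_apply h (differentiableAt_const a)]
  simp

theorem norm_gradient_sq {ι : Type*} [Fintype ι] (b : OrthonormalBasis ι ℝ E)
    {f : E → ℝ} {x : E} (hf : DifferentiableAt ℝ f x) :
    ‖∇ f x‖ ^ 2 = ∑ i, fderiv ℝ f x (b i) ^ 2 := by
  rw [← b.sum_sq_norm_inner_right]
  refine Finset.sum_congr rfl fun i _ => ?_
  rw [real_inner_comm, Real.norm_eq_abs, sq_abs, hf.hasGradientAt.hasFDerivAt.fderiv]
  simp

/-- The chain rule `Δ (F ∘ g) = F'' (g) |∇ g|² + F' (g) Δ g`. -/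
theorem laplacian_comp {F F' : ℝ → ℝ} {F'' : ℝ} {g : E → ℝ} {x : E}
    (hF : ∀ᶠ s in 𝓝 (g x), HasDerivAt F (F' s) s) (hF' : HasDerivAt F' F'' (g x))
    (hg : ContDiffAt ℝ 2 g x) :
    Laplacian.laplacian (fun y => F (g y)) x
      = F'' * ‖∇ g x‖ ^ 2 + F' (g x) * Laplacian.laplacian g x := by
  have hgd : ∀ᶠ y in 𝓝 x, DifferentiableAt ℝ g y := by
    filter_upwards [hg.eventually (by simp)] with y hy
    exact hy.differentiableAt (by norm_num)
  have h1 : fderiv ℝ (fun y => F (g y)) =ᶠ[𝓝 x] fun y => F' (g y) • fderiv ℝ g y := by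
    filter_upwards [hgd, hg.continuousAt.eventually hF] with y hy hFy
    exact (hFy.comp_hasFDerivAt y hy.hasFDerivAt).fderiv
  have h2 : HasFDerivAt (fun y => F' (g y) • fderiv ℝ g y)
      (F' (g x) • fderiv ℝ (fderiv ℝ g) x + (F'' • fderiv ℝ g x).smulRight (fderiv ℝ g x)) x := by
    have h3 : HasFDerivAt (fderiv ℝ g) (fderiv ℝ (fderiv ℝ g) x) x :=
      ((hg.fderiv_right (m := 1) (by norm_num)).differentiableAt (by norm_num)).hasFDerivAt
    have h4 : HasFDerivAt (fun y => F' (g y)) (F'' • fderiv ℝ g x) x :=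
      hF'.comp_hasFDerivAt x hgd.self_of_nhds.hasFDerivAt
    exact h4.fun_smul h3
  let b := stdOrthonormalBasis ℝ E
  rw [laplacian_eq_sum_fderiv_fderiv b, laplacian_eq_sum_fderiv_fderiv b,
    norm_gradient_sq b hgd.self_of_nhds, Finset.mul_sum, Finset.mul_sum, ← Finset.sum_add_distrib]
  refine Finset.sum_congr rfl fun i _ => ?_
  rw [h1.fderiv_eq, h2.fderiv]
  simp
  ring

theorem continuousOn_laplacian {f : E → ℝ} {U : Set E} (hU : IsOpen U) (hf : ContDiffOn ℝ 2 f U) :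
    ContinuousOn (Laplacian.laplacian f) U := by
  have h : ContinuousOn (fderiv ℝ (fderiv ℝ f)) U := by
    have h1 : ContDiffOn ℝ 1 (fderiv ℝ f) U := hf.fderiv_of_isOpen hU (by norm_num)
    exact h1.continuousOn_fderiv_of_isOpen hU le_rfl
  have h2 : ContinuousOn (fun x => ∑ i, fderiv ℝ (fderiv ℝ f) x (stdOrthonormalBasis ℝ E i)
      (stdOrthonormalBasis ℝ E i)) U := by fun_prop
  exact h2.congr fun x _ => laplacian_eq_sum_fderiv_fderiv _ f x

theorem laplacian_eq_zero_of_notMem_tsupport {f : E → ℝ} {x : E} (hx : x ∉ tsupport f) :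
    Laplacian.laplacian f x = 0 := by
  have h : f =ᶠ[𝓝 x] fun _ => 0 := by
    filter_upwards [(isClosed_tsupport f).isOpen_compl.mem_nhds hx] with y hy
    exact image_eq_zero_of_notMem_tsupport hy
  rw [(InnerProductSpace.laplacian_congr_nhds h).self_of_nhds]
  simp

theorem laplacian_norm_sub_sq (x y : E) :
    Laplacian.laplacian (fun z : E => ‖z - x‖ ^ 2) y = 2 * Module.finrank ℝ E := by
  have h1 : fderiv ℝ (fun z : E => ‖z - x‖ ^ 2) = fun z => (2 : ℝ) • innerSL ℝ (z - x) := by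
    ext1 z
    exact (((hasFDerivAt_id z).sub_const x).norm_sq).fderiv.trans (by ext; simp)
  have h2 : HasFDerivAt (fun z : E => (2 : ℝ) • innerSL ℝ (z - x)) ((2 : ℝ) • innerSL ℝ) y :=
    ((innerSL ℝ (E := E)).hasFDerivAt.comp y ((hasFDerivAt_id y).sub_const x)).const_smul (2 : ℝ)
  rw [laplacian_eq_sum_fderiv_fderiv (stdOrthonormalBasis ℝ E), h1, h2.fderiv]
  have h3 : ∀ i, innerSL ℝ (stdOrthonormalBasis ℝ E i) (stdOrthonormalBasis ℝ E i) = 1 := by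
    intro i
    rw [innerSL_apply_apply]
    simp
  have h4 : ∀ i, ((2 : ℝ) • innerSL ℝ) (stdOrthonormalBasis ℝ E i) (stdOrthonormalBasis ℝ E i)
      = 2 := fun i => (congrArg ((2 : ℝ) * ·) (h3 i)).trans (mul_one 2)
  rw [Finset.sum_congr rfl fun i _ => h4 i]
  simp [mul_comm]

theorem gradient_norm_sub_sq (x y : E) :
    ∇ (fun z : E => ‖z - x‖ ^ 2) y = (2 : ℝ) • (y - x) := by
  refine HasGradientAt.gradient ?_
  rw [hasGradientAt_iff_hasFDerivAt]
  refine ((hasFDerivAt_id y).sub_const x).norm_sq.congr_fderiv ?_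
  ext v
  simp

variable [MeasurableSpace E] [BorelSpace E]

variable {ν : Measure E}

theorem integrable_mul_of_tsupport_subset {E : Type*} [TopologicalSpace E] [MeasurableSpace E]
    [OpensMeasurableSpace E] {ν : Measure E} [IsFiniteMeasureOnCompacts ν] {f v : E → ℝ}
    {U : Set E} (hU : IsOpen U)
    (hf : ContinuousOn f U) (hv : Continuous v) (hvc : HasCompactSupport v)
    (hvU : tsupport v ⊆ U) : Integrable (fun x => f x * v x) ν :=
  ((hf.mul hv.continuousOn).continuous_of_tsupport_subset hU
    ((tsupport_mul_subset_right (f := f) (g := v)).trans hvU)).integrable_of_hasCompactSupport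
    (hvc.mul_left)

/-- Green's second identity, one of the functions having compact support. -/
theorem integral_mul_laplacian_comm [ν.IsAddHaarMeasure] {u v : E → ℝ} {U : Set E} (hU : IsOpen U)
    (hu : ContDiffOn ℝ 2 u U) (hv : ContDiff ℝ 2 v) (hvc : HasCompactSupport v)
    (hvU : tsupport v ⊆ U) :
    ∫ x, u x * Laplacian.laplacian v x ∂ν = ∫ x, Laplacian.laplacian u x * v x ∂ν := by
  let b := stdOrthonormalBasis ℝ E
  have huU : ∀ x ∈ tsupport v, ContDiffAt ℝ 2 u x := fun x hx =>
    hu.contDiffAt (hU.mem_nhds (hvU hx))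
  have hv1 : ∀ e, ContDiff ℝ 1 fun x => fderiv ℝ v x e := fun e =>
    (hv.fderiv_right (m := 1) (by norm_num)).clm_apply contDiff_const
  have hv1U : ∀ e, tsupport (fun x => fderiv ℝ v x e) ⊆ tsupport v := fun e =>
    tsupport_fderiv_apply_subset ℝ e
  have hu1 : ∀ e, ContDiffOn ℝ 1 (fun x => fderiv ℝ u x e) U := fun e =>
    (hu.fderiv_of_isOpen hU (m := 1) (by norm_num)).clm_apply contDiffOn_const
  have hv2 : ∀ e, Continuous fun x => fderiv ℝ (fun y => fderiv ℝ v y e) x e := fun e =>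
    ((hv1 e).continuous_fderiv (by norm_num)).clm_apply continuous_const
  have hu2 : ∀ e, ContinuousOn (fun x => fderiv ℝ (fun y => fderiv ℝ u y e) x e) U := fun e =>
    ((hu1 e).continuousOn_fderiv_of_isOpen hU le_rfl).clm_apply continuousOn_const
  have hc1 : ∀ e, HasCompactSupport fun x => fderiv ℝ v x e := fun e => hvc.fderiv_apply ℝ e
  have hi1 : ∀ e, Integrable (fun x => u x * fderiv ℝ (fun y => fderiv ℝ v y e) x e) ν := fun e =>
    integrable_mul_of_tsupport_subset hU hu.continuousOn (hv2 e) ((hc1 e).fderiv_apply ℝ e)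
      ((tsupport_fderiv_apply_subset ℝ e).trans ((hv1U e).trans hvU))
  have hi2 : ∀ e, Integrable (fun x => fderiv ℝ (fun y => fderiv ℝ u y e) x e * v x) ν := fun e =>
    integrable_mul_of_tsupport_subset hU (hu2 e) hv.continuous hvc hvU
  have hi3 : ∀ e, Integrable (fun x => fderiv ℝ u x e * fderiv ℝ v x e) ν := fun e =>
    integrable_mul_of_tsupport_subset hU (hu1 e).continuousOn (hv1 e).continuous (hc1 e)
      ((hv1U e).trans hvU)
  have key : ∀ e, ∫ x, u x * fderiv ℝ (fun y => fderiv ℝ v y e) x e ∂ν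
      = ∫ x, fderiv ℝ (fun y => fderiv ℝ u y e) x e * v x ∂ν := by
    intro e
    rw [integral_mul_fderiv_eq_neg_fderiv_mul_of_integrable (hi3 e) (hi1 e)
      (integrable_mul_of_tsupport_subset hU hu.continuousOn (hv1 e).continuous (hc1 e)
        ((hv1U e).trans hvU))
      (fun x hx => (huU x (hv1U e hx)).differentiableAt (by norm_num))
      (fun x _ => (hv1 e).contDiffAt.differentiableAt (by norm_num))]
    have h := integral_mul_fderiv_eq_neg_fderiv_mul_of_integrable (μ := ν) (f := v)
      (g := fun x => fderiv ℝ u x e) (v := e) ((hi3 e).congr (.of_forall fun x => mul_comm _ _))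
      ((hi2 e).congr (.of_forall fun x => mul_comm _ _))
      ((integrable_mul_of_tsupport_subset hU (hu1 e).continuousOn hv.continuous hvc hvU).congr
        (.of_forall fun x => mul_comm _ _))
      (fun x _ => hv.contDiffAt.differentiableAt (by norm_num))
      (fun x hx => ((hu1 e).contDiffAt (hU.mem_nhds (hvU hx))).differentiableAt (by norm_num))
    simp only [mul_comm (fderiv ℝ v _ e), mul_comm (v _)] at h
    exact h.symm
  have e1 : ∀ x, u x * Laplacian.laplacian v x
      = ∑ i, u x * fderiv ℝ (fun y => fderiv ℝ v y (b i)) x (b i) := by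
    intro x
    rw [laplacian_eq_sum_fderiv_fderiv b, Finset.mul_sum]
    simp only [fderiv_fderiv_apply hv.contDiffAt]
  have e2 : ∀ x, Laplacian.laplacian u x * v x
      = ∑ i, fderiv ℝ (fun y => fderiv ℝ u y (b i)) x (b i) * v x := by
    intro x
    by_cases hx : x ∈ tsupport v
    · rw [laplacian_eq_sum_fderiv_fderiv b, Finset.sum_mul]
      simp only [fderiv_fderiv_apply (huU x hx)]
    · simp [image_eq_zero_of_notMem_tsupport hx]
  simp only [e1, e2]
  rw [integral_finsetSum _ fun i _ => hi1 _, integral_finsetSum _ fun i _ => hi2 _]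
  exact Finset.sum_congr rfl fun i _ => key _

end Calculus

/-! ### The fundamental solution away from its pole -/

/-- Half the flux density of the fundamental solution through the unit sphere,
`1 / (2 σ_N)`, where `σ_N = 2 π ^ (N / 2) / Γ (N / 2)`. -/
def fluxConst (n : ℕ) : ℝ := 1 / (2 * (2 * Real.pi ^ ((n : ℝ) / 2) / Real.Gamma ((n : ℝ) / 2)))

/-- The fundamental solution as a function of the squared distance to the pole. The squared
distance makes its derivative a pure power in every dimension `n ≥ 2`. -/
def radialProfile (n : ℕ) (s : ℝ) : ℝ :=
  if n = 2 then -(fundConst n / 2 * Real.log s) else fundConst n * s ^ ((2 - (n : ℝ)) / 2)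

theorem fluxConst_pos {n : ℕ} (hn : 2 ≤ n) : 0 < fluxConst n := by
  have : (0 : ℝ) < n := by positivity
  unfold fluxConst
  have := Real.Gamma_pos_of_pos (half_pos this)
  positivity

theorem fundConst_two : fundConst 2 = 2 * fluxConst 2 := by
  simp [fundConst, fluxConst]
  ring

theorem fundConst_of_three_le {n : ℕ} (hn : 3 ≤ n) :
    fundConst n * ((n : ℝ) - 2) = 2 * fluxConst n := by
  have h3 : (3 : ℝ) ≤ n := by exact_mod_cast hn
  have hG := Real.Gamma_pos_of_pos (show (0 : ℝ) < (n : ℝ) / 2 by linarith)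
  have hp : (0 : ℝ) < Real.pi ^ ((n : ℝ) / 2) := by positivity
  have h2 : (n : ℝ) - 2 ≠ 0 := by linarith
  unfold fundConst fluxConst
  rw [max_eq_left (by linarith)]
  field_simp

theorem fundSol_eq_radialProfile {n : ℕ} (hn : 2 ≤ n) (x y : EuclideanSpace ℝ (Fin n)) :
    fundSol x y = radialProfile n (‖y - x‖ ^ 2) := by
  unfold fundSol radialProfile
  rw [norm_sub_rev]
  split_ifs with h
  · rw [Real.log_pow]
    push_cast
    ring
  · rw [div_eq_mul_inv, ← Real.rpow_natCast _ 2, ← Real.rpow_mul (norm_nonneg _),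
      ← Real.rpow_natCast, ← Real.rpow_neg (norm_nonneg _)]
    congr 2
    push_cast [Nat.cast_sub hn]
    ring

theorem hasDerivAt_radialProfile {n : ℕ} (hn : 2 ≤ n) {s : ℝ} (hs : 0 < s) :
    HasDerivAt (radialProfile n) (-fluxConst n * s ^ (-(n : ℝ) / 2)) s := by
  rcases hn.eq_or_lt with rfl | h3
  · have h := ((Real.hasDerivAt_log hs.ne').const_mul (fundConst 2 / 2)).neg
    have e : radialProfile 2 = fun s => -(fundConst 2 / 2 * Real.log s) := by
      ext s
      simp [radialProfile]
    rw [e]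
    convert! h using 1
    rw [fundConst_two]
    norm_num [Real.rpow_neg_one]
  · have h := (Real.hasDerivAt_rpow_const (p := (2 - (n : ℝ)) / 2) (Or.inl hs.ne')).const_mul
      (fundConst n)
    have e : radialProfile n = fun s => fundConst n * s ^ ((2 - (n : ℝ)) / 2) := by
      ext s
      simp [radialProfile, show n ≠ 2 by omega]
    rw [e]
    convert! h using 1
    have h2 := fundConst_of_three_le h3
    have e2 : (2 - (n : ℝ)) / 2 - 1 = -(n : ℝ) / 2 := by ring
    rw [e2]
    linear_combination (s ^ (-(n : ℝ) / 2) / 2) * h2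

theorem hasDerivAt_deriv_radialProfile (n : ℕ) {s : ℝ} (hs : 0 < s) :
    HasDerivAt (fun s : ℝ => -fluxConst n * s ^ (-(n : ℝ) / 2))
      (fluxConst n * ((n : ℝ) / 2) * s ^ (-(n : ℝ) / 2 - 1)) s := by
  convert! (Real.hasDerivAt_rpow_const (p := -(n : ℝ) / 2) (Or.inl hs.ne')).const_mul
    (-fluxConst n) using 1
  ring

theorem contDiffAt_radialProfile (n : ℕ) {m : WithTop ℕ∞} {s : ℝ} (hs : 0 < s) :
    ContDiffAt ℝ m (radialProfile n) s := by
  unfold radialProfile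
  split_ifs
  · exact (contDiffAt_const.mul (Real.contDiffAt_log.2 hs.ne')).neg
  · exact contDiffAt_const.mul (Real.contDiffAt_rpow_const_of_ne hs.ne')

theorem strictAntiOn_radialProfile {n : ℕ} (hn : 2 ≤ n) :
    StrictAntiOn (radialProfile n) (Set.Ioi 0) := by
  refine strictAntiOn_of_deriv_neg (convex_Ioi 0)
    (fun s hs => (hasDerivAt_radialProfile hn hs).continuousAt.continuousWithinAt) fun s hs => ?_
  rw [interior_Ioi] at hs
  rw [(hasDerivAt_radialProfile hn hs).deriv]
  have := fluxConst_pos hn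
  have := Real.rpow_pos_of_pos hs (-(n : ℝ) / 2)
  nlinarith

theorem fundConst_pos {n : ℕ} (hn : 2 ≤ n) : 0 < fundConst n := by
  have h : (0 : ℝ) < n := by positivity
  have := Real.Gamma_pos_of_pos (half_pos h)
  unfold fundConst
  have : (0 : ℝ) < max ((n : ℝ) - 2) 1 := by simp
  positivity

theorem tendsto_radialProfile_zero {n : ℕ} (hn : 2 ≤ n) :
    Tendsto (radialProfile n) (𝓝[>] 0) atTop := by
  have hC := fundConst_pos hn
  unfold radialProfile
  split_ifs with h
  · have := Real.tendsto_log_nhdsGT_zero.const_mul_atBot (half_pos hC)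
    exact tendsto_neg_atBot_atTop.comp this
  · refine Tendsto.const_mul_atTop hC ?_
    have h3 : (3 : ℝ) ≤ n := by exact_mod_cast (show 3 ≤ n by omega)
    exact tendsto_rpow_neg_nhdsGT_zero (by linarith)

section Fund

variable {n : ℕ}

theorem contDiff_norm_sub_sq_add (x : EuclideanSpace ℝ (Fin n)) (ε : ℝ) {m : WithTop ℕ∞} :
    ContDiff ℝ m fun z : EuclideanSpace ℝ (Fin n) => ‖z - x‖ ^ 2 + ε :=
  ((contDiff_id.sub contDiff_const).norm_sq ℝ).add contDiff_const

theorem laplacian_radialProfile (hn : 2 ≤ n) (x y : EuclideanSpace ℝ (Fin n)) {ε : ℝ}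
    (h : 0 < ‖y - x‖ ^ 2 + ε) :
    Laplacian.laplacian (fun z => radialProfile n (‖z - x‖ ^ 2 + ε)) y
      = -(2 * n * fluxConst n * ε * (‖y - x‖ ^ 2 + ε) ^ (-(n : ℝ) / 2 - 1)) := by
  have hg : ContDiff ℝ 2 fun z : EuclideanSpace ℝ (Fin n) => ‖z - x‖ ^ 2 :=
    (contDiff_id.sub contDiff_const).norm_sq ℝ
  have hF : ∀ s : ℝ, 0 < s + ε → HasDerivAt (fun s => radialProfile n (s + ε))
      (-fluxConst n * (s + ε) ^ (-(n : ℝ) / 2)) s := fun s hs =>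
    (hasDerivAt_radialProfile hn hs).comp_add_const s ε
  have hF2 := (hasDerivAt_deriv_radialProfile n h).comp_add_const _ ε
  have hev : ∀ᶠ s in 𝓝 (‖y - x‖ ^ 2), 0 < s + ε :=
    (continuous_id.add continuous_const).continuousAt.eventually (lt_mem_nhds h)
  rw [laplacian_comp (g := fun z : EuclideanSpace ℝ (Fin n) => ‖z - x‖ ^ 2)
    (F := fun s => radialProfile n (s + ε)) (hev.mono hF) hF2 hg.contDiffAt,
    laplacian_norm_sub_sq, gradient_norm_sub_sq, norm_smul, finrank_euclideanSpace_fin]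
  have e : (‖y - x‖ ^ 2 + ε) ^ (-(n : ℝ) / 2)
      = (‖y - x‖ ^ 2 + ε) ^ (-(n : ℝ) / 2 - 1) * (‖y - x‖ ^ 2 + ε) := by
    rw [← Real.rpow_add_one h.ne']
    congr 1
    ring
  rw [e]
  norm_num
  ring

theorem contDiffAt_radialProfile_norm (x y : EuclideanSpace ℝ (Fin n)) {ε : ℝ}
    {m : WithTop ℕ∞} (h : 0 < ‖y - x‖ ^ 2 + ε) :
    ContDiffAt ℝ m (fun z => radialProfile n (‖z - x‖ ^ 2 + ε)) y :=
  (contDiffAt_radialProfile n h).comp y (contDiff_norm_sub_sq_add x ε).contDiffAt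

theorem contDiffAt_fundSol (hn : 2 ≤ n) {x y : EuclideanSpace ℝ (Fin n)} {m : WithTop ℕ∞}
    (h : y ≠ x) : ContDiffAt ℝ m (fundSol x) y := by
  have h0 : 0 < ‖y - x‖ ^ 2 := by
    have := norm_pos_iff.2 (sub_ne_zero.2 h)
    positivity
  have e : fundSol x = fun z => radialProfile n (‖z - x‖ ^ 2 + 0) := by
    ext z
    rw [fundSol_eq_radialProfile hn, add_zero]
  rw [e]
  exact contDiffAt_radialProfile_norm x y (by simpa using h0)

theorem harmonicAt_fundSol (hn : 2 ≤ n) {x y : EuclideanSpace ℝ (Fin n)} (h : y ≠ x) :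
    InnerProductSpace.HarmonicAt (fundSol x) y := by
  refine ⟨contDiffAt_fundSol hn h, ?_⟩
  filter_upwards [isOpen_ne.mem_nhds h] with z hz
  have h0 : 0 < ‖z - x‖ ^ 2 := by
    have := norm_pos_iff.2 (sub_ne_zero.2 hz)
    positivity
  have e : fundSol x = fun z => radialProfile n (‖z - x‖ ^ 2 + 0) := by
    ext z
    rw [fundSol_eq_radialProfile hn, add_zero]
  rw [e, laplacian_radialProfile hn x z (by simpa using h0)]
  simp

theorem hasGradientAt_fundSol (hn : 2 ≤ n) {x y : EuclideanSpace ℝ (Fin n)} (h : y ≠ x) :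
    HasGradientAt (fundSol x)
      ((-(2 * fluxConst n) * (‖y - x‖ ^ 2) ^ (-(n : ℝ) / 2)) • (y - x)) y := by
  have h0 : 0 < ‖y - x‖ ^ 2 := by
    have := norm_pos_iff.2 (sub_ne_zero.2 h)
    positivity
  have e : fundSol x = fun z => radialProfile n (‖z - x‖ ^ 2) := by
    ext z
    rw [fundSol_eq_radialProfile hn]
  rw [e, hasGradientAt_iff_hasFDerivAt]
  have h1 := (hasDerivAt_radialProfile hn h0).comp_hasFDerivAt y
    ((hasFDerivAt_id y).sub_const x).norm_sq
  refine h1.congr_fderiv ?_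
  ext v
  simp
  ring

theorem tendsto_fundSol_pole (hn : 2 ≤ n) (x : EuclideanSpace ℝ (Fin n)) :
    Tendsto (fundSol x) (𝓝[≠] x) atTop := by
  have e : fundSol x = radialProfile n ∘ fun z => ‖z - x‖ ^ 2 := by
    ext z
    rw [fundSol_eq_radialProfile hn, Function.comp]
  rw [e]
  refine (tendsto_radialProfile_zero hn).comp (tendsto_nhdsWithin_iff.2 ⟨?_, ?_⟩)
  · refine tendsto_nhdsWithin_of_tendsto_nhds ?_
    have : Continuous fun z => ‖z - x‖ ^ 2 := by fun_prop
    simpa using this.tendsto x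
  · filter_upwards [self_mem_nhdsWithin] with z hz
    have := norm_pos_iff.2 (sub_ne_zero.2 hz)
    simp only [Set.mem_Ioi]
    positivity

theorem measurable_fundSol {α : Type*} [MeasurableSpace α] {f g : α → EuclideanSpace ℝ (Fin n)}
    (hf : Measurable f) (hg : Measurable g) :
    Measurable fun p => fundSol (f p) (g p) := by
  unfold fundSol
  split_ifs <;> fun_prop

theorem integrableOn_fundSol_ball (hn : 2 ≤ n) (x : EuclideanSpace ℝ (Fin n)) (r : ℝ) :
    IntegrableOn (fundSol x) (Metric.ball x r) := by
  have : Nonempty (Fin n) := ⟨⟨0, by omega⟩⟩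
  let f : ℝ → ℝ := fun t => if n = 2 then -(fundConst n * Real.log t)
    else fundConst n / t ^ (n - 2)
  have h1 : IntegrableOn (fun z : EuclideanSpace ℝ (Fin n) => f ‖z‖) (Metric.ball 0 r) := by
    rw [integrableOn_fun_norm_addHaar, finrank_euclideanSpace_fin]
    by_cases h : n = 2
    · subst h
      have hc : Continuous fun t : ℝ => -fundConst 2 * (t * Real.log t) :=
        continuous_const.mul Real.continuous_mul_log
      refine ((hc.integrableOn_Icc (a := 0) (b := r)).mono_set Set.Ioo_subset_Icc_self).congr_fun
        (fun t _ => ?_) measurableSet_Ioo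
      simp [f]
      ring
    · have hc : Continuous fun t : ℝ => fundConst n * t := by fun_prop
      refine ((hc.integrableOn_Icc (a := 0) (b := r)).mono_set Set.Ioo_subset_Icc_self).congr_fun
        (fun t ht => ?_) measurableSet_Ioo
      have ht0 : t ≠ 0 := ht.1.ne'
      obtain ⟨k, rfl⟩ : ∃ k, n = k + 2 := ⟨n - 2, by omega⟩
      simp only [f, if_neg h, smul_eq_mul, Nat.add_sub_cancel, show k + 2 - 1 = k + 1 by omega]
      field_simp
      ring
  have h2 := h1.integrable_indicator Metric.isOpen_ball.measurableSet
  have h3 := h2.comp_sub_right x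
  rw [← integrable_indicator_iff Metric.isOpen_ball.measurableSet]
  refine h3.congr (.of_forall fun z => ?_)
  by_cases hz : z ∈ Metric.ball x r
  · have hz' : z - x ∈ Metric.ball 0 r := by simpa [dist_eq_norm] using hz
    simp [hz, hz', Set.indicator, fundSol, f, norm_sub_rev]
  · have hz' : z - x ∉ Metric.ball 0 r := by simpa [dist_eq_norm] using hz
    simp only [Set.indicator_of_notMem hz, Set.indicator_of_notMem hz']

theorem locallyIntegrable_fundSol (hn : 2 ≤ n) (x : EuclideanSpace ℝ (Fin n)) :
    LocallyIntegrable (fundSol x) := by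
  intro y
  exact ⟨Metric.ball x (dist y x + 1), Metric.isOpen_ball.mem_nhds (by simp),
    integrableOn_fundSol_ball hn x _⟩

end Fund

/-! ### The fundamental solution as a distribution -/

/-- Minus the Laplacian of `z ↦ radialProfile n (‖z‖ ^ 2 + 1)`, the fundamental solution
regularised at unit scale. -/
def peak (n : ℕ) (z : EuclideanSpace ℝ (Fin n)) : ℝ :=
  2 * n * fluxConst n * (1 + ‖z‖ ^ 2) ^ (-(n : ℝ) / 2 - 1)

theorem integral_pow_mul_one_add_sq_rpow {n : ℕ} (hn : 1 ≤ n) :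
    ∫ y in Set.Ioi (0 : ℝ), y ^ (n - 1) * (1 + y ^ 2) ^ (-(n : ℝ) / 2 - 1) = 1 / (n : ℝ) := by
  have hn0 : (0 : ℝ) < n := by positivity
  have hd : ∀ y : ℝ, HasDerivAt (fun y : ℝ => y ^ n * (1 + y ^ 2) ^ (-(n : ℝ) / 2) / n)
      (y ^ (n - 1) * (1 + y ^ 2) ^ (-(n : ℝ) / 2 - 1)) y := by
    intro y
    have h1 : 0 < 1 + y ^ 2 := by positivity
    have hs : HasDerivAt (fun y : ℝ => 1 + y ^ 2) (2 * y) y := by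
      simpa using (hasDerivAt_pow 2 y).const_add 1
    convert! ((hasDerivAt_pow n y).mul
      (hs.rpow_const (p := -(n : ℝ) / 2) (Or.inl h1.ne'))).div_const (n : ℝ) using 1
    have e : (1 + y ^ 2) ^ (-(n : ℝ) / 2)
        = (1 + y ^ 2) ^ (-(n : ℝ) / 2 - 1) * (1 + y ^ 2) := by
      rw [← Real.rpow_add_one h1.ne']
      congr 1
      ring
    obtain ⟨k, rfl⟩ : ∃ k, n = k + 1 := ⟨n - 1, by omega⟩
    rw [e, Nat.add_sub_cancel]
    field_simp
    ring
  have hlim : Tendsto (fun y : ℝ => y ^ n * (1 + y ^ 2) ^ (-(n : ℝ) / 2) / n) atTop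
      (𝓝 (1 / (n : ℝ))) := by
    refine Tendsto.div_const ?_ _
    have h1 : Tendsto (fun y : ℝ => 1 + y ^ 2) atTop atTop :=
      tendsto_atTop_add_const_left _ _ (tendsto_pow_atTop (by norm_num))
    have h2 : Tendsto (fun y : ℝ => (1 - (1 + y ^ 2)⁻¹) ^ ((n : ℝ) / 2)) atTop (𝓝 1) := by
      have h3 : Tendsto (fun y : ℝ => 1 - (1 + y ^ 2)⁻¹) atTop (𝓝 1) := by
        simpa using tendsto_const_nhds.sub (tendsto_inv_atTop_zero.comp h1)
      simpa using h3.rpow_const (p := (n : ℝ) / 2) (Or.inl one_ne_zero)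
    refine h2.congr' ?_
    filter_upwards [eventually_gt_atTop 0] with y hy
    have h4 : 0 < 1 + y ^ 2 := by positivity
    have e : 1 - (1 + y ^ 2)⁻¹ = y ^ 2 * (1 + y ^ 2)⁻¹ := by field_simp; ring
    rw [e, Real.mul_rpow (by positivity) (by positivity), Real.inv_rpow h4.le, neg_div,
      Real.rpow_neg h4.le, ← Real.rpow_natCast y 2, ← Real.rpow_mul hy.le, ← Real.rpow_natCast y n]
    congr 2
    push_cast
    ring
  have := integral_Ioi_of_hasDerivAt_of_nonneg' (a := 0) (fun y _ => hd y)
    (fun y hy => mul_nonneg (pow_nonneg (le_of_lt hy) _) (by positivity)) hlim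
  rw [this, zero_pow (by omega)]
  simp

theorem integral_peak {n : ℕ} (hn : 2 ≤ n) : ∫ z, peak n z = 1 := by
  have : Nonempty (Fin n) := ⟨⟨0, by omega⟩⟩
  have hn0 : (0 : ℝ) < n := by positivity
  have hG := Real.Gamma_pos_of_pos (half_pos hn0)
  have h := integral_fun_norm_addHaar (volume : Measure (EuclideanSpace ℝ (Fin n)))
    (fun r => 2 * n * fluxConst n * (1 + r ^ 2) ^ (-(n : ℝ) / 2 - 1))
  simp only [smul_eq_mul, finrank_euclideanSpace_fin, nsmul_eq_mul] at h
  simp only [fun y : ℝ => mul_left_comm (y ^ (n - 1)) (2 * n * fluxConst n)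
    ((1 + y ^ 2) ^ (-(n : ℝ) / 2 - 1)), integral_const_mul] at h
  change ∫ z, 2 * n * fluxConst n * (1 + ‖z‖ ^ 2) ^ (-(n : ℝ) / 2 - 1) = 1
  rw [integral_const_mul, h, integral_pow_mul_one_add_sq_rpow (by omega), Measure.real,
    EuclideanSpace.volume_ball]
  have hv : Real.sqrt Real.pi ^ n = Real.pi ^ ((n : ℝ) / 2) := by
    rw [Real.sqrt_eq_rpow, ← Real.rpow_natCast, ← Real.rpow_mul Real.pi_pos.le]
    congr 1
    ring
  have hp : (0 : ℝ) < Real.pi ^ ((n : ℝ) / 2) := by positivity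
  rw [Fintype.card_fin, hv, Real.Gamma_add_one (by positivity)]
  simp only [ENNReal.ofReal_one, one_pow, one_mul]
  rw [ENNReal.toReal_ofReal (by positivity)]
  unfold fluxConst
  field_simp

theorem tendsto_norm_pow_mul_peak {n : ℕ} (hn : 2 ≤ n) :
    Tendsto (fun z => ‖z‖ ^ n * peak n z) (Bornology.cobounded (EuclideanSpace ℝ (Fin n)))
      (𝓝 0) := by
  have hA := fluxConst_pos hn
  have h1 : Tendsto (fun z : EuclideanSpace ℝ (Fin n) => 2 * n * fluxConst n * (1 + ‖z‖ ^ 2)⁻¹)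
      (Bornology.cobounded _) (𝓝 0) := by
    have h2 : Tendsto (fun z : EuclideanSpace ℝ (Fin n) => 1 + ‖z‖ ^ 2)
        (Bornology.cobounded _) atTop :=
      tendsto_atTop_add_const_left _ _
        ((tendsto_pow_atTop (by norm_num)).comp tendsto_norm_cobounded_atTop)
    simpa using (tendsto_inv_atTop_zero.comp h2).const_mul (2 * n * fluxConst n)
  refine squeeze_zero (fun z => ?_) (fun z => ?_) h1
  · unfold peak
    positivity
  · have h4 : 0 < 1 + ‖z‖ ^ 2 := by positivity
    have e : (1 + ‖z‖ ^ 2) ^ (-(n : ℝ) / 2 - 1)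
        = ((1 + ‖z‖ ^ 2) ^ ((n : ℝ) / 2))⁻¹ * (1 + ‖z‖ ^ 2)⁻¹ := by
      rw [Real.rpow_sub_one h4.ne', neg_div, Real.rpow_neg h4.le, div_eq_mul_inv]
    have h5 : ‖z‖ ^ n ≤ (1 + ‖z‖ ^ 2) ^ ((n : ℝ) / 2) := by
      have : ‖z‖ ^ n = (‖z‖ ^ 2) ^ ((n : ℝ) / 2) := by
        rw [← Real.rpow_natCast _ 2, ← Real.rpow_mul (norm_nonneg _), ← Real.rpow_natCast]
        congr 1
        push_cast
        ring
      rw [this]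
      gcongr
      linarith
    have h6 : 0 < (1 + ‖z‖ ^ 2) ^ ((n : ℝ) / 2) := by positivity
    unfold peak
    rw [e]
    calc ‖z‖ ^ n * (2 * n * fluxConst n * (((1 + ‖z‖ ^ 2) ^ ((n : ℝ) / 2))⁻¹ * (1 + ‖z‖ ^ 2)⁻¹))
        = ‖z‖ ^ n * ((1 + ‖z‖ ^ 2) ^ ((n : ℝ) / 2))⁻¹
          * (2 * n * fluxConst n * (1 + ‖z‖ ^ 2)⁻¹) := by ring
      _ ≤ 1 * (2 * n * fluxConst n * (1 + ‖z‖ ^ 2)⁻¹) := by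
          gcongr
          rw [← div_eq_mul_inv]
          exact (div_le_one h6).2 h5
      _ = _ := one_mul _

/-- `fundSol x` is the fundamental solution of `-Δ` with pole `x`. The proof passes to the limit
in the smooth regularisations `y ↦ radialProfile n (‖y - x‖² + c⁻²)`, whose Laplacians are
rescalings of `-peak n`, an approximate identity. -/
theorem integral_fundSol_mul_laplacian {n : ℕ} (hn : 2 ≤ n) (x : EuclideanSpace ℝ (Fin n))
    {φ : EuclideanSpace ℝ (Fin n) → ℝ} (hφ : ContDiff ℝ 2 φ) (hφc : HasCompactSupport φ) :
    Integrable (fun y => fundSol x y * Laplacian.laplacian φ y) ∧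
      ∫ y, fundSol x y * Laplacian.laplacian φ y = -φ x := by
  have : Nonempty (Fin n) := ⟨⟨0, by omega⟩⟩
  have hn0 : (0 : ℝ) < n := by positivity
  have hΔ : Continuous (Laplacian.laplacian φ) := by
    rw [← continuousOn_univ]
    exact continuousOn_laplacian isOpen_univ hφ.contDiffOn
  have hΔc : HasCompactSupport (Laplacian.laplacian φ) :=
    HasCompactSupport.intro hφc fun y hy => laplacian_eq_zero_of_notMem_tsupport hy
  have hi : Integrable (fun y => fundSol x y * Laplacian.laplacian φ y) := by
    simpa [mul_comm] using
      (locallyIntegrable_fundSol hn x).integrable_smul_left_of_hasCompactSupport hΔ hΔc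
  refine ⟨hi, ?_⟩
  let P : ℝ → EuclideanSpace ℝ (Fin n) → ℝ := fun ε y => radialProfile n (‖y - x‖ ^ 2 + ε)
  have hPc : ∀ ε : ℝ, 0 < ε → ContDiff ℝ 2 (P ε) := fun ε hε =>
    contDiff_iff_contDiffAt.2 fun y => contDiffAt_radialProfile_norm x y (by positivity)
  have hG : ∀ c : ℝ, 0 < c → ∫ y, P (c⁻¹ ^ 2) y * Laplacian.laplacian φ y
      = -∫ y, (c ^ n * peak n (c • (x - y))) • φ y := by
    intro c hc
    rw [integral_mul_laplacian_comm isOpen_univ (hPc _ (by positivity)).contDiffOn hφ hφc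
      (Set.subset_univ _), ← integral_neg]
    refine integral_congr_ae (.of_forall fun y => ?_)
    have h0 : 0 < ‖y - x‖ ^ 2 + c⁻¹ ^ 2 := by positivity
    have e1 : 1 + ‖c • (x - y)‖ ^ 2 = c ^ 2 * (‖y - x‖ ^ 2 + c⁻¹ ^ 2) := by
      rw [norm_smul, norm_sub_rev, Real.norm_of_nonneg hc.le]
      field_simp
      ring
    have e2 : (c ^ 2) ^ (-(n : ℝ) / 2 - 1) = (c ^ n)⁻¹ * (c⁻¹) ^ 2 := by
      rw [← Real.rpow_natCast c 2, ← Real.rpow_mul hc.le, inv_pow, ← Real.rpow_natCast c 2,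
        ← Real.rpow_natCast c n, ← Real.rpow_neg hc.le, ← Real.rpow_neg hc.le, ← Real.rpow_add hc]
      congr 1
      push_cast
      ring
    simp only [P, smul_eq_mul, peak]
    rw [laplacian_radialProfile hn x y h0, e1, Real.mul_rpow (by positivity) h0.le, e2]
    field_simp
  have hR : Tendsto (fun c : ℝ => -∫ y, (c ^ n * peak n (c • (x - y))) • φ y) atTop
      (𝓝 (-φ x)) := by
    have h := tendsto_integral_comp_smul_smul_of_integrable' (μ := volume) (φ := peak n) (x₀ := x)
      (fun z => by
        have := fluxConst_pos hn
        unfold peak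
        positivity) (integral_peak hn)
      (by simpa using tendsto_norm_pow_mul_peak hn)
      (hφ.continuous.integrable_of_hasCompactSupport hφc) hφ.continuous.continuousAt
    simpa using h.neg
  have hL : Tendsto (fun c : ℝ => ∫ y, P (c⁻¹ ^ 2) y * Laplacian.laplacian φ y) atTop
      (𝓝 (∫ y, fundSol x y * Laplacian.laplacian φ y)) := by
    have hε : Tendsto (fun c : ℝ => c⁻¹ ^ 2) atTop (𝓝 0) := by
      simpa using (tendsto_inv_atTop_zero (𝕜 := ℝ)).pow 2
    have hbi : Integrable fun y => |fundSol x y * Laplacian.laplacian φ y|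
        + |P 1 y * Laplacian.laplacian φ y| :=
      hi.abs.add (integrable_mul_of_tsupport_subset isOpen_univ
        (hPc 1 one_pos).continuous.continuousOn hΔ hΔc (Set.subset_univ _)).abs
    have hne : ∀ᵐ y : EuclideanSpace ℝ (Fin n), y ≠ x := by
      simp [ae_iff]
    refine tendsto_integral_filter_of_dominated_convergence _ ?_ ?_ hbi ?_
    · filter_upwards [eventually_gt_atTop 0] with c hc
      exact ((hPc _ (by positivity)).continuous.mul hΔ).aestronglyMeasurable
    · filter_upwards [eventually_ge_atTop 1] with c hc
      filter_upwards [hne] with y hy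
      have hy0 : 0 < ‖y - x‖ ^ 2 := by
        have := norm_pos_iff.2 (sub_ne_zero.2 hy)
        positivity
      have hc0 : 0 < c⁻¹ ^ 2 := by positivity
      have hc1 : c⁻¹ ^ 2 ≤ 1 := pow_le_one₀ (by positivity) (inv_le_one_of_one_le₀ hc)
      have hanti := (strictAntiOn_radialProfile hn).antitoneOn
      have h1 : P (c⁻¹ ^ 2) y ≤ fundSol x y := by
        rw [fundSol_eq_radialProfile hn]
        exact hanti hy0 (by simp only [Set.mem_Ioi]; positivity) (by linarith)
      have h2 : P 1 y ≤ P (c⁻¹ ^ 2) y :=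
        hanti (by simp only [Set.mem_Ioi]; positivity) (by simp only [Set.mem_Ioi]; positivity)
          (by linarith)
      rw [Real.norm_eq_abs, abs_mul, abs_mul, abs_mul, ← add_mul]
      gcongr
      rw [abs_le]
      constructor
      · linarith [neg_abs_le (P 1 y), abs_nonneg (fundSol x y)]
      · linarith [le_abs_self (fundSol x y), abs_nonneg (P 1 y)]
    · filter_upwards [hne] with y hy
      refine Tendsto.mul_const _ ?_
      have hy0 : 0 < ‖y - x‖ ^ 2 := by
        have := norm_pos_iff.2 (sub_ne_zero.2 hy)
        positivity
      rw [fundSol_eq_radialProfile hn]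
      refine (hasDerivAt_radialProfile hn hy0).continuousAt.tendsto.comp ?_
      simpa using hε.const_add (‖y - x‖ ^ 2)
  refine tendsto_nhds_unique hL (hR.congr' ?_)
  filter_upwards [eventually_gt_atTop 0] with c hc
  exact (hG c hc).symm

/-! ### The representation formula over level sets -/

open scoped Manifold in
theorem exists_contDiff_hasCompactSupport_eventuallyEq {n : ℕ}
    {K V : Set (EuclideanSpace ℝ (Fin n))} (hK : IsCompact K) (hV : IsOpen V) (hKV : K ⊆ V)
    {u : EuclideanSpace ℝ (Fin n) → ℝ} (hu : ContDiffOn ℝ 2 u V) :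
    ∃ v : EuclideanSpace ℝ (Fin n) → ℝ, ContDiff ℝ 2 v ∧ HasCompactSupport v ∧ tsupport v ⊆ V ∧
      ∀ y ∈ K, v =ᶠ[𝓝 y] u := by
  obtain ⟨L, hL, hKL, hLV⟩ := exists_compact_between hK hV hKV
  obtain ⟨f, h1, h0, -⟩ := exists_contMDiffMap_one_nhds_of_subset_interior (n := 2)
    𝓘(ℝ, EuclideanSpace ℝ (Fin n)) hK.isClosed hKL
  have hf : ContDiff ℝ 2 f := f.contMDiff.contDiff
  have hfs : tsupport f ⊆ L := closure_minimal
    (fun x hx => by_contra fun h => hx (h0 x h)) hL.isClosed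
  have hvs : tsupport (fun x => f x * u x) ⊆ tsupport f := tsupport_mul_subset_left
  refine ⟨fun x => f x * u x, contDiff_iff_contDiffAt.2 fun x => ?_,
    hL.of_isClosed_subset (isClosed_tsupport _) (hvs.trans hfs), (hvs.trans hfs).trans hLV,
    fun y hy => ?_⟩
  · by_cases hx : x ∈ tsupport fun x => f x * u x
    · exact hf.contDiffAt.mul (hu.contDiffAt (hV.mem_nhds (hLV (hfs (hvs hx)))))
    · exact contDiffAt_const.congr_of_eventuallyEq (notMem_tsupport_iff_eventuallyEq.1 hx)
  · filter_upwards [h1.filter_mono (nhds_le_nhdsSet hy)] with z hz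
    simp [hz]

/-- The second primitive `∫₀ˢ (s - t) w(t) dt` of a weight `w` on the half-line. -/
def weightPotential (w : ℝ → ℝ) (s : ℝ) : ℝ := ∫ t in (0 : ℝ)..s, (s - t) * w t

section Weight

variable {w ζ : ℝ → ℝ} {a b s : ℝ}

theorem weightPotential_eq (hw : Continuous w) (s : ℝ) :
    weightPotential w s = s * (∫ t in (0 : ℝ)..s, w t) - ∫ t in (0 : ℝ)..s, t * w t := by
  unfold weightPotential
  rw [← intervalIntegral.integral_const_mul, ← intervalIntegral.integral_sub]
  · exact intervalIntegral.integral_congr fun t _ => sub_mul _ _ _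
  · exact (continuous_const.mul hw).intervalIntegrable _ _
  · exact (continuous_id.mul hw).intervalIntegrable _ _

theorem hasDerivAt_weightPotential (hw : Continuous w) (s : ℝ) :
    HasDerivAt (weightPotential w) (∫ t in (0 : ℝ)..s, w t) s := by
  have e : weightPotential w
      = fun s => s * (∫ t in (0 : ℝ)..s, w t) - ∫ t in (0 : ℝ)..s, t * w t :=
    funext fun s => weightPotential_eq hw s
  rw [e]
  have h1 := (hasDerivAt_id s).mul (hw.integral_hasStrictDerivAt 0 s).hasDerivAt
  have h2 := ((continuous_id.mul hw).integral_hasStrictDerivAt 0 s).hasDerivAt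
  refine (h1.sub h2).congr_deriv ?_
  simp

theorem weightPotential_eq_zero (hw : ∀ t < a, w t = 0) (ha : 0 < a) (hs : s ≤ a) :
    weightPotential w s = 0 := by
  unfold weightPotential
  have : ∀ t ∈ Set.uIcc 0 s, (s - t) * w t = 0 := by
    intro t ht
    rcases lt_or_ge t a with h | h
    · simp [hw t h]
    · have : t ≤ max 0 s := ht.2
      have h2 : t ≤ s := (le_max_iff.1 this).resolve_left (by linarith)
      rw [le_antisymm h2 (hs.trans h)]
      simp
  rw [intervalIntegral.integral_congr this]
  simp

theorem integral_eq_of_support (hw : Continuous w) (hwa : ∀ t < a, w t = 0)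
    (hwb : ∀ t, b < t → w t = 0) (ha : 0 < a) (hs : b ≤ s) :
    ∫ t in (0 : ℝ)..s, w t = ∫ t in a..b, w t := by
  have hi : ∀ p q, IntervalIntegrable w volume p q := fun p q => hw.intervalIntegrable p q
  rw [← intervalIntegral.integral_add_adjacent_intervals (hi 0 a) (hi a s),
    ← intervalIntegral.integral_add_adjacent_intervals (hi a b) (hi b s)]
  have h1 : ∫ t in (0 : ℝ)..a, w t = 0 := by
    rw [intervalIntegral.integral_of_le ha.le, integral_Ioc_eq_integral_Ioo]
    exact setIntegral_eq_zero_of_forall_eq_zero fun t ht => hwa t ht.2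
  have h2 : ∫ t in b..s, w t = 0 := by
    rw [intervalIntegral.integral_of_le hs]
    exact setIntegral_eq_zero_of_forall_eq_zero fun t ht => hwb t ht.1
  rw [h1, h2]
  ring

theorem exists_weightPotential_eq (hw : Continuous w) (hwa : ∀ t < a, w t = 0)
    (hwb : ∀ t, b < t → w t = 0) (ha : 0 < a) :
    ∃ C, ∀ s, b ≤ s → (∫ t in a..b, w t) * s - weightPotential w s = C := by
  refine ⟨∫ t in a..b, t * w t, fun s hs => ?_⟩
  rw [weightPotential_eq hw, integral_eq_of_support hw hwa hwb ha hs,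
    integral_eq_of_support (w := fun t => t * w t) (continuous_id.mul hw)
      (fun t ht => by simp [hwa t ht]) (fun t ht => by simp [hwb t ht]) ha hs]
  ring

theorem abs_weightPotential_le (hζ : Continuous ζ) (h : ∀ t, |w t| ≤ ζ t) (hs : 0 ≤ s) :
    |weightPotential w s| ≤ weightPotential ζ s := by
  unfold weightPotential
  rw [← Real.norm_eq_abs]
  refine intervalIntegral.norm_integral_le_of_norm_le hs (.of_forall fun t ht => ?_)
    (((continuous_const.sub continuous_id).mul hζ).intervalIntegrable _ _)
  rw [Real.norm_eq_abs, abs_mul, abs_of_nonneg (sub_nonneg.2 ht.2)]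
  exact mul_le_mul_of_nonneg_left (h t) (sub_nonneg.2 ht.2)

theorem weightPotential_nonneg (hw : ∀ t, 0 ≤ w t) (hs : 0 ≤ s) : 0 ≤ weightPotential w s :=
  intervalIntegral.integral_nonneg hs fun t ht => mul_nonneg (sub_nonneg.2 ht.2) (hw t)

end Weight

/-- `g` is a function on the open set `V` that differs from the fundamental solution with pole
`x ∈ V` by a harmonic function, and whose superlevel set `{g ≥ a}` is contained in the compact
subset `K ∋ x` of `V`. -/
structure IsGreenLike {n : ℕ} (V K : Set (EuclideanSpace ℝ (Fin n)))
    (x : EuclideanSpace ℝ (Fin n)) (g : EuclideanSpace ℝ (Fin n) → ℝ) (a : ℝ) : Prop where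
  isOpen : IsOpen V
  isCompact : IsCompact K
  subset : K ⊆ V
  mem : x ∈ K
  harmonic : InnerProductSpace.HarmonicOnNhd (fun y => g y - fundSol x y) V
  mem_of_le : ∀ y ∈ V, a ≤ g y → y ∈ K

namespace IsGreenLike

variable {n : ℕ} {V K : Set (EuclideanSpace ℝ (Fin n))} {x : EuclideanSpace ℝ (Fin n)}
  {g : EuclideanSpace ℝ (Fin n) → ℝ} {a b : ℝ} {w : ℝ → ℝ}

theorem harmonicAt (h : IsGreenLike V K x g a) (hn : 2 ≤ n) {y : EuclideanSpace ℝ (Fin n)}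
    (hy : y ∈ V) (hyx : y ≠ x) : InnerProductSpace.HarmonicAt g y := by
  have := (h.harmonic y hy).add (harmonicAt_fundSol hn hyx)
  convert! this using 1
  ext z
  simp

theorem tendsto_pole (h : IsGreenLike V K x g a) (hn : 2 ≤ n) : Tendsto g (𝓝[≠] x) atTop := by
  have h1 := (h.harmonic x (h.subset h.mem)).1.continuousAt.tendsto.mono_left
    (nhdsWithin_le_nhds (s := {x}ᶜ))
  refine ((tendsto_fundSol_pole hn x).atTop_add h1).congr fun y => ?_
  ring

theorem integral_mul_laplacian (h : IsGreenLike V K x g a) (hn : 2 ≤ n)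
    {v : EuclideanSpace ℝ (Fin n) → ℝ} (hv : ContDiff ℝ 2 v) (hvc : HasCompactSupport v)
    (hvV : tsupport v ⊆ V) :
    Integrable (fun y => g y * Laplacian.laplacian v y) ∧
      ∫ y, g y * Laplacian.laplacian v y = -v x := by
  have hΔ : Continuous (Laplacian.laplacian v) := by
    rw [← continuousOn_univ]
    exact continuousOn_laplacian isOpen_univ hv.contDiffOn
  have hΔs : tsupport (Laplacian.laplacian v) ⊆ tsupport v :=
    closure_minimal (fun y hy => by_contra fun hy' =>
      hy (laplacian_eq_zero_of_notMem_tsupport hy')) (isClosed_tsupport v)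
  have hΔc : HasCompactSupport (Laplacian.laplacian v) :=
    hvc.of_isClosed_subset (isClosed_tsupport _) hΔs
  obtain ⟨hi, he⟩ := integral_fundSol_mul_laplacian hn x hv hvc
  have hh := h.harmonic.contDiffOn
  have hi2 := integrable_mul_of_tsupport_subset (ν := volume) h.isOpen hh.continuousOn hΔ hΔc
    (hΔs.trans hvV)
  have he2 : ∫ y, (g y - fundSol x y) * Laplacian.laplacian v y = 0 := by
    rw [integral_mul_laplacian_comm h.isOpen hh hv hvc hvV]
    refine integral_eq_zero_of_ae (.of_forall fun y => ?_)
    by_cases hy : y ∈ tsupport v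
    · simp [(h.harmonic y (hvV hy)).2.self_of_nhds]
    · simp [image_eq_zero_of_notMem_tsupport hy]
  have e : (fun y => g y * Laplacian.laplacian v y)
      = fun y => fundSol x y * Laplacian.laplacian v y
        + (g y - fundSol x y) * Laplacian.laplacian v y := by
    ext y
    ring
  rw [e]
  refine ⟨hi.add hi2, ?_⟩
  rw [integral_add hi hi2, he, he2, add_zero]

/-- The representation formula over the level sets of `g`, integrated against a weight `w` of the
levels. With `Q(s) = (∫ w) s - weightPotential w s`, the function `Q ∘ g` is constant near the
pole, so that Green's second identity applies to it, and `g` itself is a fundamental solution. -/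
theorem representation (h : IsGreenLike V K x g a) (hn : 2 ≤ n) (hw : Continuous w)
    (hwa : ∀ t < a, w t = 0) (hwb : ∀ t, b < t → w t = 0) (ha : 0 < a)
    {u : EuclideanSpace ℝ (Fin n) → ℝ} (hu : ContDiffOn ℝ 2 u V) :
    IntegrableOn (fun y => w (g y) * ‖∇ g y‖ ^ 2 * u y) V ∧
    IntegrableOn (fun y => weightPotential w (g y) * Laplacian.laplacian u y) V ∧
    ∫ y in V, w (g y) * ‖∇ g y‖ ^ 2 * u y = (∫ t in a..b, w t) * u x
      + ∫ y in V, weightPotential w (g y) * Laplacian.laplacian u y := by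
  classical
  have : Nonempty (Fin n) := ⟨⟨0, by omega⟩⟩
  set I := ∫ t in a..b, w t with hI
  obtain ⟨C, hC⟩ := exists_weightPotential_eq hw hwa hwb ha
  obtain ⟨v, hv, hvc, hvV, hvu⟩ :=
    exists_contDiff_hasCompactSupport_eventuallyEq h.isCompact h.isOpen h.subset hu
  obtain ⟨hgi, hge⟩ := h.integral_mul_laplacian hn hv hvc hvV
  have hΔ : Continuous (Laplacian.laplacian v) := by
    rw [← continuousOn_univ]
    exact continuousOn_laplacian isOpen_univ hv.contDiffOn
  have hΔs : tsupport (Laplacian.laplacian v) ⊆ tsupport v :=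
    closure_minimal (fun y hy => by_contra fun hy' =>
      hy (laplacian_eq_zero_of_notMem_tsupport hy')) (isClosed_tsupport v)
  have hΔc : HasCompactSupport (Laplacian.laplacian v) :=
    hvc.of_isClosed_subset (isClosed_tsupport _) hΔs
  -- `Q ∘ g`, with the removable singularity at the pole removed
  let Q : EuclideanSpace ℝ (Fin n) → ℝ :=
    fun y => if y = x then C else I * g y - weightPotential w (g y)
  have hQx : Q =ᶠ[𝓝 x] fun _ => C := by
    have := (h.tendsto_pole hn).eventually (eventually_ge_atTop b)
    rw [eventually_nhdsWithin_iff] at this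
    filter_upwards [this] with y hy
    by_cases hyx : y = x
    · simp [Q, hyx]
    · simp only [Q, if_neg hyx]
      exact hC _ (hy hyx)
  have hQg : ∀ y, y ≠ x → Q =ᶠ[𝓝 y] fun z => I * g z - weightPotential w (g z) := by
    intro y hy
    filter_upwards [isOpen_ne.mem_nhds hy] with z hz
    simp only [Q, if_neg (show z ≠ x from hz)]
  have hD1 : ∀ s, HasDerivAt (fun s => I * s - weightPotential w s)
      (I - ∫ t in (0 : ℝ)..s, w t) s := fun s =>
    (((hasDerivAt_id s).const_mul I).fun_sub (hasDerivAt_weightPotential hw s)).congr_deriv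
      (by simp)
  have hD2 : ∀ s, HasDerivAt (fun s => I - ∫ t in (0 : ℝ)..s, w t) (-w s) s := fun s => by
    simpa using (hw.integral_hasStrictDerivAt 0 s).hasDerivAt.const_sub I
  have hqc : ContDiff ℝ 2 fun s => I * s - weightPotential w s := by
    rw [show (2 : WithTop ℕ∞) = 1 + 1 by norm_num, contDiff_succ_iff_deriv]
    refine ⟨fun s => (hD1 s).differentiableAt, by simp, ?_⟩
    rw [show deriv (fun s => I * s - weightPotential w s) = _ from funext fun s => (hD1 s).deriv,
      contDiff_one_iff_deriv,
      show deriv (fun s => I - ∫ t in (0 : ℝ)..s, w t) = _ from funext fun s => (hD2 s).deriv]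
    exact ⟨fun s => (hD2 s).differentiableAt, hw.neg⟩
  have hQ : ContDiffOn ℝ 2 Q V := by
    intro y hy
    refine ContDiffAt.contDiffWithinAt ?_
    by_cases hyx : y = x
    · rw [hyx]
      exact contDiffAt_const.congr_of_eventuallyEq hQx
    · exact (hqc.contDiffAt.comp y (h.harmonicAt hn hy hyx).1).congr_of_eventuallyEq (hQg y hyx)
  have hΔQ : ∀ y ∈ V, y ≠ x → Laplacian.laplacian Q y = -(w (g y) * ‖∇ g y‖ ^ 2) := by
    intro y hy hyx
    have hg := h.harmonicAt hn hy hyx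
    rw [(InnerProductSpace.laplacian_congr_nhds (hQg y hyx)).self_of_nhds,
      laplacian_comp (.of_forall hD1) (hD2 (g y)) hg.1, hg.2.self_of_nhds]
    simp
  have hne : ∀ᵐ y : EuclideanSpace ℝ (Fin n), y ≠ x := by
    simp [ae_iff]
  have hQi := integrable_mul_of_tsupport_subset (ν := volume) h.isOpen hQ.continuousOn hΔ hΔc
    (hΔs.trans hvV)
  have hQi2 := integrable_mul_of_tsupport_subset (ν := volume) h.isOpen
    (continuousOn_laplacian h.isOpen hQ) hv.continuous hvc hvV
  have hgreen := integral_mul_laplacian_comm (ν := volume) h.isOpen hQ hv hvc hvV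
  have e1 : (fun y => Laplacian.laplacian Q y * v y)
      =ᵐ[volume] fun y => -(V.indicator (fun y => w (g y) * ‖∇ g y‖ ^ 2 * u y) y) := by
    filter_upwards [hne] with y hyx
    by_cases hy : y ∈ V
    · rw [Set.indicator_of_mem hy, hΔQ y hy hyx]
      by_cases hyK : y ∈ K
      · rw [(hvu y hyK).self_of_nhds]
        ring
      · rw [hwa _ (lt_of_not_ge fun hle => hyK (h.mem_of_le y hy hle))]
        simp
    · rw [Set.indicator_of_notMem hy, image_eq_zero_of_notMem_tsupport fun hy' => hy (hvV hy')]
      simp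
  have e2 : (fun y => I * (g y * Laplacian.laplacian v y) - Q y * Laplacian.laplacian v y)
      =ᵐ[volume]
        V.indicator (fun y => weightPotential w (g y) * Laplacian.laplacian u y) := by
    filter_upwards [hne] with y hyx
    by_cases hy : y ∈ V
    · rw [Set.indicator_of_mem hy]
      simp only [Q, if_neg hyx]
      by_cases hyK : y ∈ K
      · rw [(InnerProductSpace.laplacian_congr_nhds (hvu y hyK)).self_of_nhds]
        ring
      · rw [weightPotential_eq_zero hwa ha
          (le_of_not_ge fun hle => hyK (h.mem_of_le y hy hle))]
        ring
    · rw [Set.indicator_of_notMem hy,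
        laplacian_eq_zero_of_notMem_tsupport fun hy' => hy (hvV hy')]
      simp
  have i1 := hQi2.congr e1
  have i2 := ((hgi.const_mul I).sub hQi).congr e2
  have i1' := i1.neg
  simp only [Pi.neg_def, neg_neg] at i1'
  refine ⟨(integrable_indicator_iff h.isOpen.measurableSet).1 i1',
    (integrable_indicator_iff h.isOpen.measurableSet).1 i2, ?_⟩
  rw [← integral_indicator h.isOpen.measurableSet, ← integral_indicator h.isOpen.measurableSet,
    ← integral_congr_ae e2, integral_sub (hgi.const_mul I) hQi, integral_const_mul, hge, hgreen,
    integral_congr_ae e1, integral_neg, (hvu x h.mem).self_of_nhds]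
  ring

end IsGreenLike

/-! ### The Green function of the half-space -/

section Geometry

variable {d : ℕ} {x y : EuclideanSpace ℝ (Fin (d + 1))}

theorem reflect_last (x : EuclideanSpace ℝ (Fin (d + 1))) :
    reflect x (Fin.last d) = -x (Fin.last d) := by
  simp [reflect]

theorem reflect_castSucc (x : EuclideanSpace ℝ (Fin (d + 1))) (i : Fin d) :
    reflect x i.castSucc = x i.castSucc := by
  simp [reflect]

theorem norm_sub_reflect_sq (x y : EuclideanSpace ℝ (Fin (d + 1))) :
    ‖y - reflect x‖ ^ 2 = ‖y - x‖ ^ 2 + 4 * x (Fin.last d) * y (Fin.last d) := by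
  rw [EuclideanSpace.norm_sq_eq, EuclideanSpace.norm_sq_eq, Fin.sum_univ_castSucc,
    Fin.sum_univ_castSucc]
  simp only [PiLp.sub_apply, reflect_last, reflect_castSucc, Real.norm_eq_abs, sq_abs]
  ring

theorem continuous_reflect : Continuous (reflect (d := d)) := by
  unfold reflect
  refine (PiLp.continuous_toLp 2 _).comp ?_
  refine Continuous.update (PiLp.continuous_ofLp 2 _) _ ?_
  fun_prop

theorem isOpen_halfSpace : IsOpen (halfSpace d) :=
  isOpen_lt continuous_const (by fun_prop)

theorem green_eq (hd : 1 ≤ d) (x y : EuclideanSpace ℝ (Fin (d + 1))) :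
    green x y = radialProfile (d + 1) (‖y - x‖ ^ 2)
      - radialProfile (d + 1) (‖y - x‖ ^ 2 + 4 * x (Fin.last d) * y (Fin.last d)) := by
  rw [green, fundSol_eq_radialProfile (by omega), fundSol_eq_radialProfile (by omega),
    norm_sub_reflect_sq]

theorem green_comm (hd : 1 ≤ d) (x y : EuclideanSpace ℝ (Fin (d + 1))) :
    green x y = green y x := by
  rw [green_eq hd, green_eq hd, norm_sub_rev]
  ring_nf

theorem green_pos (hd : 1 ≤ d) (hx : x ∈ halfSpace d) (hy : y ∈ halfSpace d) (h : y ≠ x) :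
    0 < green x y := by
  have h0 := norm_pos_iff.2 (sub_ne_zero.2 h)
  have hxy : 0 < 4 * x (Fin.last d) * y (Fin.last d) :=
    mul_pos (mul_pos four_pos hx) hy
  rw [green_eq hd, sub_pos]
  exact strictAntiOn_radialProfile (by omega) (by simp only [Set.mem_Ioi]; positivity)
    (by simp only [Set.mem_Ioi]; positivity) (by linarith)

/-- The upper bound that makes `green x` vanish at the boundary and at infinity: the mean value
theorem for `radialProfile` between `‖y - x‖ ^ 2` and `‖y - reflect x‖ ^ 2`. -/
theorem green_le (hd : 1 ≤ d) (hx : x ∈ halfSpace d) (hy : y ∈ halfSpace d) (h : y ≠ x) :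
    green x y ≤ fluxConst (d + 1) * (‖y - x‖ ^ 2) ^ (-((d + 1 : ℕ) : ℝ) / 2)
      * (4 * x (Fin.last d) * y (Fin.last d)) := by
  have h0 : 0 < ‖y - x‖ ^ 2 := by
    have := norm_pos_iff.2 (sub_ne_zero.2 h)
    positivity
  have hxy : 0 < 4 * x (Fin.last d) * y (Fin.last d) :=
    mul_pos (mul_pos four_pos hx) hy
  rw [green_eq hd]
  set s := ‖y - x‖ ^ 2
  set δ := 4 * x (Fin.last d) * y (Fin.last d)
  obtain ⟨c, hc, he⟩ := exists_hasDerivAt_eq_slope (radialProfile (d + 1))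
    (fun t => -fluxConst (d + 1) * t ^ (-((d + 1 : ℕ) : ℝ) / 2)) (a := s) (b := s + δ)
    (by linarith)
    (fun t ht => (hasDerivAt_radialProfile (by omega)
      (h0.trans_le ht.1)).continuousAt.continuousWithinAt)
    (fun t ht => hasDerivAt_radialProfile (by omega) (h0.trans ht.1))
  have hA := fluxConst_pos (n := d + 1) (by omega)
  have hle : c ^ (-((d + 1 : ℕ) : ℝ) / 2) ≤ s ^ (-((d + 1 : ℕ) : ℝ) / 2) :=
    Real.rpow_le_rpow_of_nonpos h0 hc.1.le (by
      have : (0 : ℝ) ≤ ((d + 1 : ℕ) : ℝ) := Nat.cast_nonneg _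
      linarith)
  rw [add_sub_cancel_left, eq_div_iff hxy.ne'] at he
  have := mul_le_mul_of_nonneg_right (mul_le_mul_of_nonneg_left hle hA.le) hxy.le
  linarith

theorem abs_last_sub_le (x y : EuclideanSpace ℝ (Fin (d + 1))) :
    |y (Fin.last d) - x (Fin.last d)| ≤ ‖y - x‖ := by
  simpa using PiLp.norm_apply_le (y - x) (Fin.last d)

theorem reflect_notMem_halfSpace (hx : x ∈ halfSpace d) : reflect x ∉ halfSpace d := by
  have : 0 < x (Fin.last d) := hx
  simp only [halfSpace, Set.mem_ofPred_eq, reflect_last]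
  linarith

/-- The superlevel sets of the Green function are relatively compact in the half-space. -/
theorem exists_isGreenLike_green (hd : 1 ≤ d) (hx : x ∈ halfSpace d) {t : ℝ} (ht : 0 < t) :
    ∃ K, IsGreenLike (halfSpace d) K x (green x) t := by
  have hn : 2 ≤ d + 1 := by omega
  have hA := fluxConst_pos hn
  have h0 : 0 < x (Fin.last d) := hx
  set h := x (Fin.last d) with hh
  set A := fluxConst (d + 1)
  set M := ((h / 2) ^ 2) ^ (-((d + 1 : ℕ) : ℝ) / 2) with hM
  have hM0 : 0 < M := by positivity
  have hexp : -((d + 1 : ℕ) : ℝ) / 2 ≤ 0 := by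
    have : (0 : ℝ) ≤ ((d + 1 : ℕ) : ℝ) := Nat.cast_nonneg _
    linarith
  -- a point within `η` of the boundary or at distance more than `ρ` from `x` has `green x y < t`,
  -- by `green_le`
  set η := min (h / 2) (t / (4 * A * M * h)) with hη
  set ρ := max (max 1 h) (8 * A * h / t) with hρ
  have hη0 : 0 < η := by positivity
  have hηh : η ≤ h := (min_le_left _ _).trans (half_le_self h0.le)
  refine ⟨{y | η ≤ y (Fin.last d)} ∩ Metric.closedBall x ρ, isOpen_halfSpace,
    (isCompact_closedBall x ρ).inter_left (isClosed_le continuous_const (by fun_prop)),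
    fun y hy => hη0.trans_le hy.1, ⟨?_, ?_⟩, ?_, ?_⟩
  · exact hηh
  · exact Metric.mem_closedBall_self (by positivity)
  · intro y hy
    have : (fun y => green x y - fundSol x y) = -fundSol (reflect x) := by
      ext y
      simp [green]
    rw [this]
    exact (harmonicAt_fundSol hn (ne_of_mem_of_not_mem hy (reflect_notMem_halfSpace hx))).neg
  · intro y hy hty
    have hy0 : 0 < y (Fin.last d) := hy
    by_cases hyx : y = x
    · rw [hyx]
      exact ⟨hηh, Metric.mem_closedBall_self (by positivity)⟩
    have hG := hty.trans (green_le hd hx hy hyx)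
    have hlast := abs_le.1 (abs_last_sub_le x y)
    have hp := norm_pos_iff.2 (sub_ne_zero.2 hyx)
    set r := ‖y - x‖ with hr
    refine ⟨show η ≤ y (Fin.last d) from le_of_not_gt fun hlt => ?_,
      Metric.mem_closedBall.2 (le_of_not_gt fun hlt => ?_)⟩
    · have h1 : y (Fin.last d) < h / 2 := hlt.trans_le (min_le_left _ _)
      have h2 : y (Fin.last d) < t / (4 * A * M * h) := hlt.trans_le (min_le_right _ _)
      rw [lt_div_iff₀ (by positivity)] at h2
      have h3 : h / 2 ≤ r := by linarith
      have h4 : (r ^ 2) ^ (-((d + 1 : ℕ) : ℝ) / 2) ≤ M :=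
        Real.rpow_le_rpow_of_nonpos (by positivity) (by gcongr) hexp
      have h5 : A * (r ^ 2) ^ (-((d + 1 : ℕ) : ℝ) / 2) * (4 * h * y (Fin.last d))
          ≤ A * M * (4 * h * y (Fin.last d)) := by gcongr
      linarith
    · rw [dist_eq_norm, ← hr] at hlt
      have h1 : 1 < r := ((le_max_left _ _).trans (le_max_left _ _)).trans_lt hlt
      have h2 : h < r := ((le_max_right _ _).trans (le_max_left _ _)).trans_lt hlt
      have h3 : 8 * A * h / t < r := (le_max_right _ _).trans_lt hlt
      rw [div_lt_iff₀ ht] at h3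
      have h4 : (r ^ 2) ^ (-((d + 1 : ℕ) : ℝ) / 2) ≤ (r ^ 2)⁻¹ := by
        rw [← Real.rpow_neg_one]
        refine Real.rpow_le_rpow_of_exponent_le (by nlinarith) ?_
        have : (1 : ℝ) ≤ d := by exact_mod_cast hd
        push_cast
        linarith
      have h5 : A * (r ^ 2) ^ (-((d + 1 : ℕ) : ℝ) / 2) * (4 * h * y (Fin.last d))
          ≤ A * (r ^ 2)⁻¹ * (4 * h * (2 * r)) := by
        gcongr
        linarith
      have h6 : A * (r ^ 2)⁻¹ * (4 * h * (2 * r)) = 8 * A * h / r := by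
        field_simp
        ring
      rw [h6] at h5
      have h7 := hG.trans h5
      rw [le_div_iff₀ hp] at h7
      linarith

theorem measurable_green {α : Type*} [MeasurableSpace α] {f g : α → EuclideanSpace ℝ (Fin (d + 1))}
    (hf : Measurable f) (hg : Measurable g) :
    Measurable fun p => green (f p) (g p) := by
  have hr : Measurable (reflect (d := d)) := continuous_reflect.measurable
  unfold green
  exact (measurable_fundSol hf hg).sub (measurable_fundSol (hr.comp hf) hg)

end Geometry

section Ring

variable {d : ℕ} {x : EuclideanSpace ℝ (Fin (d + 1))}

theorem IsGreenLike.representation_of_tendsto {n : ℕ} {V K : Set (EuclideanSpace ℝ (Fin n))}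
    {x : EuclideanSpace ℝ (Fin n)} {g : EuclideanSpace ℝ (Fin n) → ℝ} {a b : ℝ}
    (h : IsGreenLike V K x g a) (hn : 2 ≤ n) {w : ℕ → ℝ → ℝ} {ζ w0 : ℝ → ℝ}
    (hw : ∀ k, Continuous (w k)) (hζ : Continuous ζ) (hwζ : ∀ k t, |w k t| ≤ ζ t)
    (hζa : ∀ t < a, ζ t = 0) (hζb : ∀ t, b < t → ζ t = 0)
    (hlim : ∀ t, Tendsto (fun k => w k t) atTop (𝓝 (w0 t)))
    (ha : 0 < a) (hg : ∀ y ∈ V, y ≠ x → 0 ≤ g y)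
    {u : EuclideanSpace ℝ (Fin n) → ℝ} (hu : ContDiffOn ℝ 2 u V) :
    IntegrableOn (fun y => w0 (g y) * ‖∇ g y‖ ^ 2 * u y) V ∧
    IntegrableOn (fun y => weightPotential w0 (g y) * Laplacian.laplacian u y) V ∧
    ∫ y in V, w0 (g y) * ‖∇ g y‖ ^ 2 * u y = (∫ t in a..b, w0 t) * u x
      + ∫ y in V, weightPotential w0 (g y) * Laplacian.laplacian u y := by
  have : Nonempty (Fin n) := ⟨⟨0, by omega⟩⟩
  have hne : ∀ᵐ y ∂volume.restrict V, y ∈ V ∧ y ≠ x := by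
    have h1 : ∀ᵐ y : EuclideanSpace ℝ (Fin n), y ≠ x := by
      simp [ae_iff]
    filter_upwards [ae_restrict_mem h.isOpen.measurableSet, ae_restrict_of_ae h1] with y h2 h3
    exact ⟨h2, h3⟩
  have hzero : ∀ k t, ζ t = 0 → w k t = 0 := fun k t ht =>
    abs_nonpos_iff.1 ((hwζ k t).trans_eq ht)
  have hk := fun k => h.representation hn (hw k) (fun t ht => hzero k t (hζa t ht))
    (fun t ht => hzero k t (hζb t ht)) ha hu
  obtain ⟨z1, z2, -⟩ := h.representation hn hζ hζa hζb ha hu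
  have hwζ0 : ∀ t, |w0 t| ≤ ζ t := fun t =>
    le_of_tendsto (hlim t).abs (.of_forall fun k => hwζ k t)
  have hΦ : ∀ s, Tendsto (fun k => weightPotential (w k) s) atTop (𝓝 (weightPotential w0 s)) := by
    intro s
    refine intervalIntegral.tendsto_integral_filter_of_dominated_convergence
      (fun t => |s - t| * ζ t) ?_ ?_ ?_ ?_
    · exact .of_forall fun k =>
        ((continuous_const.sub continuous_id).mul (hw k)).aestronglyMeasurable
    · refine .of_forall fun k => .of_forall fun t _ => ?_
      rw [Real.norm_eq_abs, abs_mul]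
      exact mul_le_mul_of_nonneg_left (hwζ k t) (abs_nonneg _)
    · exact ((continuous_const.sub continuous_id).abs.mul hζ).intervalIntegrable _ _
    · exact .of_forall fun t _ => (hlim t).const_mul _
  have l1 : ∀ k, ∀ᵐ y ∂volume.restrict V,
      ‖w k (g y) * ‖∇ g y‖ ^ 2 * u y‖ ≤ ‖ζ (g y) * ‖∇ g y‖ ^ 2 * u y‖ := by
    refine fun k => .of_forall fun y => ?_
    rw [norm_mul, norm_mul, norm_mul, norm_mul]
    gcongr
    exact (hwζ k _).trans (le_abs_self _)
  have l2 : ∀ k, ∀ᵐ y ∂volume.restrict V, ‖weightPotential (w k) (g y) * Laplacian.laplacian u y‖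
      ≤ ‖weightPotential ζ (g y) * Laplacian.laplacian u y‖ := by
    intro k
    filter_upwards [hne] with y hy
    rw [norm_mul, norm_mul]
    gcongr
    exact (abs_weightPotential_le hζ (hwζ k) (hg y hy.1 hy.2)).trans (le_abs_self _)
  have c1 : ∀ᵐ y ∂volume.restrict V, Tendsto (fun k => w k (g y) * ‖∇ g y‖ ^ 2 * u y) atTop
      (𝓝 (w0 (g y) * ‖∇ g y‖ ^ 2 * u y)) :=
    .of_forall fun y => ((hlim _).mul_const _).mul_const _
  have c2 : ∀ᵐ y ∂volume.restrict V,
      Tendsto (fun k => weightPotential (w k) (g y) * Laplacian.laplacian u y) atTop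
        (𝓝 (weightPotential w0 (g y) * Laplacian.laplacian u y)) :=
    .of_forall fun y => (hΦ _).mul_const _
  have t1 := tendsto_integral_of_dominated_convergence _ (fun k => (hk k).1.aestronglyMeasurable)
    z1.norm l1 c1
  have t2 := tendsto_integral_of_dominated_convergence _
    (fun k => (hk k).2.1.aestronglyMeasurable) z2.norm l2 c2
  have t3 : Tendsto (fun k => ∫ t in a..b, w k t) atTop (𝓝 (∫ t in a..b, w0 t)) := by
    refine intervalIntegral.tendsto_integral_filter_of_dominated_convergence ζ
      (.of_forall fun k => (hw k).aestronglyMeasurable)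
      (.of_forall fun k => .of_forall fun t _ => hwζ k t) (hζ.intervalIntegrable _ _)
      (.of_forall fun t _ => hlim t)
  refine ⟨z1.norm.mono' (aestronglyMeasurable_of_tendsto_ae _
      (fun k => (hk k).1.aestronglyMeasurable) c1) ?_,
    z2.norm.mono' (aestronglyMeasurable_of_tendsto_ae _
      (fun k => (hk k).2.1.aestronglyMeasurable) c2) ?_, ?_⟩
  · filter_upwards [c1, ae_all_iff.2 l1] with y h1 h2
    exact le_of_tendsto h1.norm (.of_forall h2)
  · filter_upwards [c2, ae_all_iff.2 l2] with y h1 h2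
    exact le_of_tendsto h1.norm (.of_forall h2)
  · refine tendsto_nhds_unique t1 (((t3.mul_const (u x)).add t2).congr fun k => ?_)
    exact (hk k).2.2.symm

end Ring

/-! ### Ring integrals and their limits -/

/-- The weight `1 / t` on the levels `a < t ≤ b`, zero elsewhere. -/
def cutInv (a b t : ℝ) : ℝ := (Set.Ioc a b).indicator (fun t => t⁻¹) t

section CutInv

variable {a b s t : ℝ}

theorem cutInv_of_mem (h : a < t ∧ t ≤ b) : cutInv a b t = t⁻¹ :=
  Set.indicator_of_mem (s := Set.Ioc a b) h _

theorem cutInv_of_notMem (h : ¬(a < t ∧ t ≤ b)) : cutInv a b t = 0 :=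
  Set.indicator_of_notMem (s := Set.Ioc a b) h _

theorem cutInv_nonneg (ha : 0 < a) (t : ℝ) : 0 ≤ cutInv a b t :=
  Set.indicator_nonneg (fun _ ht => inv_nonneg.2 (ha.trans ht.1).le) t

theorem integrable_cutInv (ha : 0 < a) : Integrable (cutInv a b) := by
  have : ContinuousOn (fun t : ℝ => t⁻¹) (Set.Icc a b) := fun t ht =>
    (continuousAt_inv₀ (ha.trans_le ht.1).ne').continuousWithinAt
  exact (integrable_indicator_iff measurableSet_Ioc).2
    (this.integrableOn_Icc.mono_set Set.Ioc_subset_Icc_self)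

theorem integral_mul_cutInv (hab : a ≤ b) {p q : ℝ} (hp : p ≤ a) (hq : b ≤ q)
    (f : ℝ → ℝ) : ∫ t in p..q, f t * cutInv a b t = ∫ t in a..b, f t * t⁻¹ := by
  rw [intervalIntegral.integral_of_le (hp.trans (hab.trans hq)),
    intervalIntegral.integral_of_le hab]
  have e : (fun t => f t * cutInv a b t) = (Set.Ioc a b).indicator fun t => f t * t⁻¹ := by
    ext t
    unfold cutInv
    by_cases ht : t ∈ Set.Ioc a b <;> simp [ht]
  rw [e, setIntegral_indicator measurableSet_Ioc,
    Set.inter_eq_self_of_subset_right (Set.Ioc_subset_Ioc hp hq)]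

theorem integral_cutInv (ha : 0 < a) (hab : a ≤ b) {p q : ℝ} (hp : p ≤ a) (hq : b ≤ q) :
    ∫ t in p..q, cutInv a b t = Real.log (b / a) := by
  have := integral_mul_cutInv hab hp hq fun _ => 1
  simp only [one_mul] at this
  rw [this, integral_inv_of_pos ha (ha.trans_le hab)]

theorem weightPotential_cutInv (ha : 0 < a) (hab : a ≤ b) (hs : b ≤ s) :
    weightPotential (cutInv a b) s = s * Real.log (b / a) - (b - a) := by
  have h0 : ∀ t ∈ Set.uIcc a b, t ≠ 0 := fun t ht => by
    rw [Set.uIcc_of_le hab] at ht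
    exact (ha.trans_le ht.1).ne'
  have hi : IntervalIntegrable (fun t : ℝ => t⁻¹) volume a b :=
    intervalIntegral.intervalIntegrable_inv h0 continuousOn_id
  unfold weightPotential
  rw [integral_mul_cutInv hab ha.le hs, ← integral_inv_of_pos ha (ha.trans_le hab),
    ← intervalIntegral.integral_const_mul]
  have h1 : (∫ _ in a..b, (1 : ℝ)) = b - a := by simp
  rw [← h1, ← intervalIntegral.integral_sub (hi.const_mul s) (by simp)]
  refine intervalIntegral.integral_congr fun t ht => ?_
  have := h0 t ht
  field_simp

theorem weightPotential_cutInv_le (ha : 0 < a) (hab : a ≤ b) (hs : 0 ≤ s) :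
    weightPotential (cutInv a b) s ≤ s * Real.log (b / a) := by
  have hi : ∀ p q, IntervalIntegrable (cutInv a b) volume p q := fun p q =>
    (integrable_cutInv ha).intervalIntegrable
  have h1 : ∫ t in (0 : ℝ)..s, cutInv a b t ≤ Real.log (b / a) := by
    rw [← integral_cutInv ha hab ha.le (le_max_right s b)]
    exact intervalIntegral.integral_mono_interval le_rfl hs (le_max_left _ _)
      (.of_forall fun t => cutInv_nonneg ha t) (hi _ _)
  refine le_trans ?_ (mul_le_mul_of_nonneg_left h1 hs)
  rw [← intervalIntegral.integral_const_mul]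
  refine intervalIntegral.integral_mono_on hs ?_ ((hi _ _).const_mul s) fun t ht => ?_
  · exact (hi 0 s).continuousOn_mul (by fun_prop)
  · exact mul_le_mul_of_nonneg_right (by linarith [ht.1]) (cutInv_nonneg ha t)

/-- `cutInv a b` is a pointwise limit of continuous trapezoidal weights. -/
theorem exists_tendsto_cutInv (ha : 0 < a) (b : ℝ) :
    ∃ (w : ℕ → ℝ → ℝ) (ζ : ℝ → ℝ), (∀ k, Continuous (w k)) ∧ Continuous ζ ∧
      (∀ k t, |w k t| ≤ ζ t) ∧ (∀ t < a / 2, ζ t = 0) ∧ (∀ t, b + 2 < t → ζ t = 0) ∧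
      ∀ t, Tendsto (fun k => w k t) atTop (𝓝 (cutInv a b t)) := by
  have hm : ∀ t : ℝ, 0 < max t a := fun t => ha.trans_le (le_max_right _ _)
  let f : ℕ → ℝ → ℝ := fun k t => max 0 (min 1 (min ((k + 1) * (t - a)) (1 + (k + 1) * (b - t))))
  have hf0 : ∀ k t, t ≤ a → f k t = 0 := fun k t ht => by
    refine max_eq_left ((min_le_right _ _).trans ((min_le_left _ _).trans ?_))
    exact mul_nonpos_of_nonneg_of_nonpos (by positivity) (by linarith)
  have hf1 : ∀ (k : ℕ) t, 1 + (k + 1 : ℝ) * (b - t) ≤ 0 → f k t = 0 := fun k t ht =>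
    max_eq_left ((min_le_right _ _).trans ((min_le_right _ _).trans ht))
  let ζ : ℝ → ℝ := fun t => max 0 (min 1 (min (2 * (t - a / 2) / a) (b + 2 - t))) * a⁻¹
  -- replacing `t` by `max t a` keeps the inverse continuous and does not matter where `f k ≠ 0`
  refine ⟨fun k t => f k t * (max t a)⁻¹, ζ, fun k => ?_, ?_, fun k t => ?_, fun t ht => ?_,
    fun t ht => ?_, fun t => ?_⟩
  · refine Continuous.mul (by fun_prop) (Continuous.inv₀ (by fun_prop) fun t => (hm t).ne')
  · fun_prop
  · change |f k t * (max t a)⁻¹| ≤ ζ t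
    have hζ0 : 0 ≤ ζ t := mul_nonneg (le_max_left _ _) (by positivity)
    by_cases h1 : t ≤ a
    · rw [hf0 k t h1]
      simpa using hζ0
    by_cases h2 : b + 1 ≤ t
    · rw [hf1 k t (by nlinarith [(k.cast_nonneg : (0 : ℝ) ≤ k)])]
      simpa using hζ0
    push Not at h1 h2
    have h3 : ζ t = a⁻¹ := by
      have : (1 : ℝ) ≤ min (2 * (t - a / 2) / a) (b + 2 - t) :=
        le_min ((one_le_div ha).2 (by linarith)) (by linarith)
      simp [ζ, min_eq_left this]
    have h4 : 0 ≤ f k t := le_max_left _ _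
    have h5 : f k t ≤ 1 := max_le zero_le_one (min_le_left _ _)
    rw [h3, abs_of_nonneg (mul_nonneg h4 (inv_nonneg.2 (hm t).le))]
    calc f k t * (max t a)⁻¹ ≤ 1 * a⁻¹ := by
          gcongr
          exact le_max_right _ _
      _ = a⁻¹ := one_mul _
  · have : 2 * (t - a / 2) / a ≤ 0 :=
      div_nonpos_of_nonpos_of_nonneg (by linarith) ha.le
    simp only [ζ]
    rw [max_eq_left ((min_le_right _ _).trans ((min_le_left _ _).trans this)), zero_mul]
  · simp only [ζ]
    rw [max_eq_left ((min_le_right _ _).trans ((min_le_right _ _).trans (by linarith))), zero_mul]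
  · refine tendsto_const_nhds.congr' ?_
    have hk : Tendsto (fun k : ℕ => (k + 1 : ℝ)) atTop atTop :=
      tendsto_atTop_add_const_right _ _ tendsto_natCast_atTop_atTop
    change ∀ᶠ k in atTop, cutInv a b t = f k t * (max t a)⁻¹
    by_cases h1 : t ≤ a
    · refine .of_forall fun k => ?_
      rw [hf0 k t h1, cutInv_of_notMem fun h => absurd h.1 h1.not_gt, zero_mul]
    push Not at h1
    by_cases h2 : t ≤ b
    · filter_upwards [(hk.atTop_mul_const (sub_pos.2 h1)).eventually (eventually_ge_atTop 1)]
        with k h3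
      have h4 : (0 : ℝ) ≤ (k + 1) * (b - t) := mul_nonneg (by positivity) (by linarith)
      have h5 : f k t = 1 := by
        have : (1 : ℝ) ≤ min ((k + 1) * (t - a)) (1 + (k + 1) * (b - t)) :=
          le_min h3 (by linarith)
        simp [f, min_eq_left this]
      rw [h5, cutInv_of_mem ⟨h1, h2⟩, one_mul, max_eq_left h1.le]
    · push Not at h2
      filter_upwards [(hk.atTop_mul_const (sub_pos.2 h2)).eventually (eventually_ge_atTop 1)]
        with k h3
      rw [hf1 k t (by linarith), cutInv_of_notMem fun h => absurd h.2 h2.not_ge, zero_mul]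

end CutInv

section Ring

variable {d : ℕ} {x y : EuclideanSpace ℝ (Fin (d + 1))} {R : ℝ}
  {u : EuclideanSpace ℝ (Fin (d + 1)) → ℝ}

theorem mem_greenRing : y ∈ greenRing x R ↔
    y ∈ halfSpace d ∧ y ≠ x ∧ 1 / (2 * R) < green x y ∧ green x y ≤ 1 / R := by
  unfold greenRing greenBall
  constructor
  · rintro ⟨h1, h2⟩
    rw [Set.mem_union, not_or] at h2
    rcases h1 with h1 | h1
    · exact ⟨h1.1, h2.2, h1.2, le_of_not_gt fun h => h2.1 ⟨h1.1, h⟩⟩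
    · exact absurd h1 h2.2
  · rintro ⟨h1, h2, h3, h4⟩
    refine ⟨Or.inl ⟨h1, h3⟩, fun h => ?_⟩
    rcases h with h | h
    · exact absurd h.2 h4.not_gt
    · exact h2 h

theorem measurable_green_right : Measurable (green x) :=
  measurable_green measurable_const measurable_id

theorem measurableSet_greenRing : MeasurableSet (greenRing x R) := by
  have e : greenRing x R = (halfSpace d ∩ {x}ᶜ) ∩ (green x ⁻¹' Set.Ioc (1 / (2 * R)) (1 / R)) := by
    ext y
    rw [mem_greenRing]
    exact ⟨fun h => ⟨⟨h.1, h.2.1⟩, h.2.2⟩, fun h => ⟨h.1.1, h.1.2, h.2⟩⟩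
  rw [e]
  exact (isOpen_halfSpace.measurableSet.inter (measurableSet_singleton x).compl).inter
    (measurable_green_right measurableSet_Ioc)

theorem ae_mem_halfSpace_ne : ∀ᵐ y ∂volume.restrict (halfSpace d), y ∈ halfSpace d ∧ y ≠ x := by
  have h1 : ∀ᵐ y : EuclideanSpace ℝ (Fin (d + 1)), y ≠ x := by
    simp [ae_iff]
  filter_upwards [ae_restrict_mem isOpen_halfSpace.measurableSet, ae_restrict_of_ae h1]
    with y h2 h3
  exact ⟨h2, h3⟩

theorem ringIntegral_eq (hd : 1 ≤ d) (hx : x ∈ halfSpace d) (hR : 0 < R)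
    (hu : ContDiffOn ℝ 2 u (halfSpace d)) :
    IntegrableOn (fun y => ‖∇ (green x) y‖ ^ 2 / green x y * u y) (greenRing x R) ∧
    IntegrableOn (fun y => weightPotential (cutInv (1 / (2 * R)) (1 / R)) (green x y)
      * Laplacian.laplacian u y) (halfSpace d) ∧
    ringIntegral u x R = Real.log 2 * u x
      + ∫ y in halfSpace d, weightPotential (cutInv (1 / (2 * R)) (1 / R)) (green x y)
        * Laplacian.laplacian u y := by
  have ha : 0 < 1 / (2 * R) := by positivity
  have hab : 1 / (2 * R) ≤ 1 / R := by
    gcongr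
    linarith
  obtain ⟨w, ζ, hw, hζ, hwζ, hζa, hζb, hlim⟩ := exists_tendsto_cutInv ha (1 / R)
  obtain ⟨K, hK⟩ := exists_isGreenLike_green hd hx (half_pos ha)
  obtain ⟨i1, i2, he⟩ := hK.representation_of_tendsto (by omega) hw hζ hwζ hζa hζb hlim
    (half_pos ha) (fun y hy hyx => (green_pos hd hx hy hyx).le) hu
  rw [integral_cutInv ha hab (by linarith) (by linarith)] at he
  have e : (fun y => cutInv (1 / (2 * R)) (1 / R) (green x y) * ‖∇ (green x) y‖ ^ 2 * u y)
      =ᵐ[volume.restrict (halfSpace d)]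
        (greenRing x R).indicator fun y => ‖∇ (green x) y‖ ^ 2 / green x y * u y := by
    filter_upwards [ae_mem_halfSpace_ne (x := x)] with y hy
    by_cases h : y ∈ greenRing x R
    · rw [Set.indicator_of_mem h, cutInv_of_mem (mem_greenRing.1 h).2.2]
      ring
    · rw [Set.indicator_of_notMem h,
          cutInv_of_notMem fun h' => h (mem_greenRing.2 ⟨hy.1, hy.2, h'⟩)]
      ring
  have hsub : greenRing x R ⊆ halfSpace d := fun y hy => (mem_greenRing.1 hy).1
  have i3 := Integrable.congr i1 e
  rw [integrable_indicator_iff measurableSet_greenRing, IntegrableOn,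
    Measure.restrict_restrict measurableSet_greenRing, Set.inter_eq_self_of_subset_left hsub] at i3
  refine ⟨i3, i2, ?_⟩
  rw [integral_congr_ae e, setIntegral_indicator measurableSet_greenRing,
    Set.inter_eq_self_of_subset_right hsub] at he
  rw [ringIntegral, he]
  congr 3
  field_simp

/-- If `Δ u ≤ 0`, then the ring integrals of `u` converge, to `ln 2` times the difference of `u`
and its Green potential if the latter is finite, and to `-∞` otherwise. -/
theorem tendsto_ringIntegral (hd : 1 ≤ d) (hx : x ∈ halfSpace d)
    (hu : ContDiffOn ℝ 2 u (halfSpace d))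
    (hΔ : ∀ y ∈ halfSpace d, Laplacian.laplacian u y ≤ 0) :
    (IntegrableOn (fun y => green x y * -Laplacian.laplacian u y) (halfSpace d) →
      Tendsto (ringIntegral u x) atTop (𝓝 (Real.log 2 *
        (u x - ∫ y in halfSpace d, green x y * -Laplacian.laplacian u y)))) ∧
    (¬IntegrableOn (fun y => green x y * -Laplacian.laplacian u y) (halfSpace d) →
      Tendsto (ringIntegral u x) atTop atBot) := by
  have hlog : 0 < Real.log 2 := Real.log_pos one_lt_two
  let Φ : ℝ → ℝ → ℝ := fun R => weightPotential (cutInv (1 / (2 * R)) (1 / R))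
  let F : ℝ → EuclideanSpace ℝ (Fin (d + 1)) → ℝ :=
    fun R y => Φ R (green x y) * -Laplacian.laplacian u y
  let G : EuclideanSpace ℝ (Fin (d + 1)) → ℝ := fun y => green x y * -Laplacian.laplacian u y
  have hring : ∀ R, 0 < R →
      ringIntegral u x R = Real.log 2 * u x - ∫ y in halfSpace d, F R y := by
    intro R hR
    rw [(ringIntegral_eq hd hx hR hu).2.2, sub_eq_add_neg, ← integral_neg]
    congr 2
    ext y
    simp [F, Φ]
  have hFi : ∀ R, 0 < R → IntegrableOn (F R) (halfSpace d) := fun R hR => by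
    have := (ringIntegral_eq hd hx hR hu).2.1.neg
    refine this.congr (.of_forall fun y => ?_)
    simp [F, Φ]
  have hlog2 : ∀ R : ℝ, 0 < R → 1 / R / (1 / (2 * R)) = 2 := fun R hR => by field_simp
  have hle : ∀ R : ℝ, 0 < R → 0 < 1 / (2 * R) ∧ 1 / (2 * R) ≤ 1 / R := fun R hR => by
    refine ⟨by positivity, ?_⟩
    gcongr
    linarith
  have hF0 : ∀ R, 0 < R → ∀ y ∈ halfSpace d, y ≠ x → 0 ≤ F R y := fun R hR y hy hyx =>
    mul_nonneg (weightPotential_nonneg (cutInv_nonneg (hle R hR).1) (green_pos hd hx hy hyx).le)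
      (neg_nonneg.2 (hΔ y hy))
  have hFle : ∀ R, 0 < R → ∀ y ∈ halfSpace d, y ≠ x → F R y ≤ Real.log 2 * G y := by
    intro R hR y hy hyx
    have := weightPotential_cutInv_le (hle R hR).1 (hle R hR).2 (green_pos hd hx hy hyx).le
    rw [hlog2 R hR] at this
    have := mul_le_mul_of_nonneg_right this (neg_nonneg.2 (hΔ y hy))
    simp only [F, G, Φ]
    linarith
  have hFlim : ∀ y ∈ halfSpace d, y ≠ x →
      Tendsto (fun R => F R y) atTop (𝓝 (Real.log 2 * G y)) := by
    intro y hy hyx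
    have h1 : Tendsto (fun R : ℝ => green x y * Real.log 2 - (1 / R - 1 / (2 * R))) atTop
        (𝓝 (green x y * Real.log 2 - (0 - 0))) := by
      refine tendsto_const_nhds.sub (Tendsto.sub ?_ ?_)
      · exact (tendsto_inv_atTop_zero (𝕜 := ℝ)).congr fun R => (one_div R).symm
      · simp only [one_div]
        exact tendsto_inv_atTop_zero.comp (tendsto_id.const_mul_atTop two_pos)
    have h2 : Tendsto (fun R => Φ R (green x y)) atTop (𝓝 (green x y * Real.log 2 - (0 - 0))) := by
      refine h1.congr' ?_
      have hg := green_pos hd hx hy hyx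
      filter_upwards [eventually_gt_atTop 0, eventually_ge_atTop (1 / green x y)] with R hR hR2
      have h3 : 1 / R ≤ green x y := by
        rw [div_le_iff₀ hg] at hR2
        rw [div_le_iff₀ hR]
        linarith
      simp only [Φ]
      rw [weightPotential_cutInv (hle R hR).1 (hle R hR).2 h3, hlog2 R hR]
    have h3 := h2.mul_const (-Laplacian.laplacian u y)
    convert h3 using 2
    simp only [G]
    ring
  have hGm : AEStronglyMeasurable G (volume.restrict (halfSpace d)) :=
    measurable_green_right.aestronglyMeasurable.mul
      ((continuousOn_laplacian isOpen_halfSpace hu).neg.aestronglyMeasurable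
        isOpen_halfSpace.measurableSet)
  constructor
  · intro hG
    have h1 : Tendsto (fun R => ∫ y in halfSpace d, F R y) atTop
        (𝓝 (∫ y in halfSpace d, Real.log 2 * G y)) := by
      refine tendsto_integral_filter_of_dominated_convergence (fun y => Real.log 2 * G y) ?_ ?_
        (hG.const_mul _) ?_
      · filter_upwards [eventually_gt_atTop 0] with R hR using (hFi R hR).aestronglyMeasurable
      · filter_upwards [eventually_gt_atTop 0] with R hR
        filter_upwards [ae_mem_halfSpace_ne (x := x)] with y hy
        rw [Real.norm_of_nonneg (hF0 R hR y hy.1 hy.2)]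
        exact hFle R hR y hy.1 hy.2
      · filter_upwards [ae_mem_halfSpace_ne (x := x)] with y hy using hFlim y hy.1 hy.2
    rw [integral_const_mul] at h1
    have h2 := h1.const_sub (Real.log 2 * u x)
    rw [← mul_sub] at h2
    refine h2.congr' ?_
    filter_upwards [eventually_gt_atTop 0] with R hR using (hring R hR).symm
  · intro hG
    rw [tendsto_atBot]
    by_contra! ⟨M, hM⟩
    obtain ⟨r, hr, hrM⟩ := exists_seq_forall_of_frequently
      ((hM.and_eventually (eventually_gt_atTop 0)))
    refine hG ?_
    have key : IntegrableOn (fun y => Real.log 2 * G y) (halfSpace d) := by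
      -- Fatou's lemma along a sequence of radii with bounded potentials
      have hc : ∀ k, ∫⁻ y in halfSpace d, ‖F (r k) y‖ₑ
          ≤ ENNReal.ofReal (Real.log 2 * u x - M) := by
        intro k
        have h0 := (hrM k).2
        have hn : 0 ≤ᵐ[volume.restrict (halfSpace d)] F (r k) := by
          filter_upwards [ae_mem_halfSpace_ne (x := x)] with y hy using hF0 _ h0 y hy.1 hy.2
        have e1 : ∫⁻ y in halfSpace d, ‖F (r k) y‖ₑ
            = ENNReal.ofReal (∫ y in halfSpace d, F (r k) y) := by
          rw [ofReal_integral_eq_lintegral_ofReal (hFi _ h0) hn]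
          refine lintegral_congr_ae ?_
          filter_upwards [hn] with y hy
          exact Real.enorm_of_nonneg hy
        rw [e1]
        refine ENNReal.ofReal_le_ofReal ?_
        have := (hrM k).1
        rw [hring _ h0] at this
        linarith
      refine ⟨hGm.const_mul _, ?_⟩
      refine lt_of_le_of_lt ?_ (ENNReal.ofReal_lt_top (r := Real.log 2 * u x - M))
      calc ∫⁻ y in halfSpace d, ‖Real.log 2 * G y‖ₑ
          = ∫⁻ y in halfSpace d, liminf (fun k => ‖F (r k) y‖ₑ) atTop := by
            refine lintegral_congr_ae ?_
            filter_upwards [ae_mem_halfSpace_ne (x := x)] with y hy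
            exact (((hFlim y hy.1 hy.2).comp hr).enorm.liminf_eq).symm
        _ ≤ liminf (fun k => ∫⁻ y in halfSpace d, ‖F (r k) y‖ₑ) atTop :=
            lintegral_liminf_le' fun k => (hFi _ (hrM k).2).aestronglyMeasurable.enorm
        _ ≤ ENNReal.ofReal (Real.log 2 * u x - M) :=
            liminf_le_of_frequently_le' (.of_forall hc)
    have := key.const_mul (Real.log 2)⁻¹
    refine this.congr (.of_forall fun y => ?_)
    simp only [G]
    field_simp

end Ring

/-! ### Mean value kernels and harmonicity -/

section Mollifier

variable {n : ℕ}

theorem norm_gradient_fundSol_sq (hn : 2 ≤ n) {x y : EuclideanSpace ℝ (Fin n)} (h : y ≠ x) :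
    ‖∇ (fundSol x) y‖ ^ 2
      = (2 * fluxConst n * (‖y - x‖ ^ 2) ^ (-(n : ℝ) / 2)) ^ 2 * ‖y - x‖ ^ 2 := by
  rw [(hasGradientAt_fundSol hn h).gradient, norm_smul, mul_pow, Real.norm_eq_abs, sq_abs]
  ring

theorem fundSol_eq_zero_sub (hn : 2 ≤ n) (x y : EuclideanSpace ℝ (Fin n)) :
    fundSol x y = fundSol 0 (y - x) := by
  rw [fundSol_eq_radialProfile hn, fundSol_eq_radialProfile hn, sub_zero]

theorem weightPotential_pos {w : ℝ → ℝ} (hw : Continuous w) (hw0 : ∀ t, 0 ≤ w t) {a b s : ℝ}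
    (hwa : ∀ t < a, w t = 0) (hwb : ∀ t, b < t → w t = 0) (ha : 0 < a) (hab : a ≤ b)
    (hI : 0 < ∫ t in a..b, w t) (hs : b < s) : 0 < weightPotential w s := by
  have h1 : ∫ t in (0 : ℝ)..s, (s - b) * w t ≤ weightPotential w s := by
    refine intervalIntegral.integral_mono_on (ha.le.trans (hab.trans hs.le))
      ((continuous_const.mul hw).intervalIntegrable _ _)
      (((continuous_const.sub continuous_id).mul hw).intervalIntegrable _ _) fun t _ => ?_
    rcases le_or_gt t b with h | h
    · exact mul_le_mul_of_nonneg_right (show s - b ≤ s - t by linarith) (hw0 t)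
    · simp [hwb t h]
  rw [intervalIntegral.integral_const_mul, integral_eq_of_support hw hwa hwb ha hs.le] at h1
  exact (mul_pos (sub_pos.2 hs) hI).trans_le h1

/-- A smooth averaging kernel `κ` on a ball of radius `r` about the origin, with the error term of
its mean value formula given by a nonnegative kernel `Ψ`. -/
theorem exists_meanValue_kernel (hn : 2 ≤ n) {r : ℝ} (hr : 0 < r) :
    ∃ κ Ψ : EuclideanSpace ℝ (Fin n) → ℝ, ContDiff ℝ 2 κ ∧ (∀ z, 0 ≤ κ z) ∧
      (∀ z, r < ‖z‖ → κ z = 0) ∧ (∀ z, 0 ≤ Ψ z) ∧ (∀ z, r < ‖z‖ → Ψ z = 0) ∧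
      (∀ᶠ z in 𝓝[≠] 0, 0 < Ψ z) ∧
      ∀ (x : EuclideanSpace ℝ (Fin n)) (V : Set (EuclideanSpace ℝ (Fin n))), IsOpen V →
        Metric.closedBall x r ⊆ V → ∀ u : EuclideanSpace ℝ (Fin n) → ℝ, ContDiffOn ℝ 2 u V →
          Integrable (fun y => κ (y - x) * u y) ∧
          Integrable (fun y => Ψ (y - x) * Laplacian.laplacian u y) ∧
          ∫ y, κ (y - x) * u y = u x + ∫ y, Ψ (y - x) * Laplacian.laplacian u y := by
  have : Nonempty (Fin n) := ⟨⟨0, by omega⟩⟩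
  set c := max (radialProfile n (r ^ 2)) 0 + 1 with hc
  let f : ContDiffBump c := ⟨1 / 4, 1 / 2, by norm_num, by norm_num⟩
  let w : ℝ → ℝ := f.normed volume
  have hwc : ContDiff ℝ 2 w := f.contDiff_normed
  have hw0 : ∀ t, 0 ≤ w t := f.nonneg_normed
  have hws : ∀ t, 1 / 2 ≤ |t - c| → w t = 0 := by
    intro t ht
    have h := f.support_normed_eq (μ := volume)
    by_contra h0
    have h1 : t ∈ Function.support w := h0
    rw [h, Metric.mem_ball, Real.dist_eq] at h1
    exact absurd h1 ht.not_gt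
  have hwa : ∀ t < c - 1 / 2, w t = 0 := fun t ht =>
    hws t (by rw [abs_sub_comm]; exact (le_abs_self _).trans' (by linarith))
  have hwb : ∀ t, c + 1 / 2 < t → w t = 0 := fun t ht =>
    hws t ((le_abs_self _).trans' (by linarith))
  have ha : 0 < c - 1 / 2 := by
    have : 0 ≤ max (radialProfile n (r ^ 2)) 0 := le_max_right _ _
    linarith
  have har : radialProfile n (r ^ 2) < c - 1 / 2 := by
    have : radialProfile n (r ^ 2) ≤ max (radialProfile n (r ^ 2)) 0 := le_max_left _ _
    linarith
  have hI : ∫ t in (c - 1 / 2)..(c + 1 / 2), w t = 1 := by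
    rw [intervalIntegral.integral_of_le (by linarith),
      setIntegral_eq_integral_of_forall_compl_eq_zero]
    · exact f.integral_normed
    · intro t ht
      rw [Set.mem_Ioc, not_and_or, not_lt, not_le] at ht
      rcases ht with ht | ht
      · exact hws t (by rw [abs_sub_comm]; exact (le_abs_self _).trans' (by linarith))
      · exact hwb t ht
  have hfar : ∀ z : EuclideanSpace ℝ (Fin n), r < ‖z‖ → fundSol 0 z < c - 1 / 2 := by
    intro z hz
    rw [fundSol_eq_radialProfile hn, sub_zero]
    refine (strictAntiOn_radialProfile hn ?_ ?_ ?_).trans har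
    · simp only [Set.mem_Ioi]
      positivity
    · have := hr.trans hz
      simp only [Set.mem_Ioi]
      positivity
    · gcongr
  have hnear := (tendsto_fundSol_pole hn (0 : EuclideanSpace ℝ (Fin n))).eventually
    (eventually_gt_atTop (c + 1 / 2))
  let κ : EuclideanSpace ℝ (Fin n) → ℝ := fun z =>
    w (fundSol 0 z) * ((2 * fluxConst n * (‖z‖ ^ 2) ^ (-(n : ℝ) / 2)) ^ 2 * ‖z‖ ^ 2)
  let Ψ : EuclideanSpace ℝ (Fin n) → ℝ := fun z => weightPotential w (fundSol 0 z)
  have hκ0 : ∀ z, r < ‖z‖ → κ z = 0 := fun z hz => by simp [κ, hwa _ (hfar z hz)]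
  have hΨ0 : ∀ z, r < ‖z‖ → Ψ z = 0 := fun z hz =>
    weightPotential_eq_zero hwa ha (hfar z hz).le
  refine ⟨κ, Ψ, ?_, fun z => mul_nonneg (hw0 _) (by positivity), hκ0, fun z => ?_, hΨ0, ?_, ?_⟩
  · rw [contDiff_iff_contDiffAt]
    intro z
    by_cases hz : z = 0
    · refine contDiffAt_const (c := (0 : ℝ)) |>.congr_of_eventuallyEq ?_
      rw [hz]
      rw [eventually_nhdsWithin_iff] at hnear
      filter_upwards [hnear] with y hy
      by_cases hy0 : y = 0
      · simp [κ, hy0]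
      · simp [κ, hwb _ (hy hy0)]
    · have h0 : ‖z‖ ^ 2 ≠ 0 := by simpa using hz
      have h1 : ContDiffAt ℝ 2 (fun z : EuclideanSpace ℝ (Fin n) => ‖z‖ ^ 2) z :=
        (contDiff_id.norm_sq ℝ).contDiffAt
      exact (hwc.contDiffAt.comp z (contDiffAt_fundSol hn hz)).mul
        (((contDiffAt_const.mul (h1.rpow_const_of_ne h0)).pow 2).mul h1)
  · rcases le_or_gt 0 (fundSol 0 z) with h | h
    · exact weightPotential_nonneg hw0 h
    · exact (weightPotential_eq_zero hwa ha (by linarith)).ge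
  · filter_upwards [hnear] with z hz
    exact weightPotential_pos hwc.continuous hw0 hwa hwb ha (by linarith) (by rw [hI]; norm_num) hz
  · intro x V hV hxV u hu
    have hG : IsGreenLike V (Metric.closedBall x r) x (fundSol x) (c - 1 / 2) := by
      refine ⟨hV, isCompact_closedBall x r, hxV, Metric.mem_closedBall_self hr.le, ?_, ?_⟩
      · intro y _
        simp
      · intro y _ hy
        rw [fundSol_eq_zero_sub hn] at hy
        rw [Metric.mem_closedBall, dist_eq_norm]
        exact le_of_not_gt fun h => (hfar _ h).not_ge hy
    obtain ⟨i1, i2, he⟩ := hG.representation hn hwc.continuous hwa hwb ha hu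
    have hout : ∀ y, y ∉ V → r < ‖y - x‖ := fun y hy => by
      rw [← dist_eq_norm]
      exact lt_of_not_ge fun h => hy (hxV h)
    have hne : ∀ᵐ y ∂volume.restrict V, y ≠ x := ae_restrict_of_ae (by simp [ae_iff])
    have e1 : (fun y => w (fundSol x y) * ‖∇ (fundSol x) y‖ ^ 2 * u y)
        =ᵐ[volume.restrict V] fun y => κ (y - x) * u y := by
      filter_upwards [hne] with y hy
      rw [norm_gradient_fundSol_sq hn hy, fundSol_eq_zero_sub hn]
    have e2 : (fun y => weightPotential w (fundSol x y) * Laplacian.laplacian u y)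
        = fun y => Ψ (y - x) * Laplacian.laplacian u y := by
      ext y
      rw [fundSol_eq_zero_sub hn]
    rw [e2] at i2 he
    rw [integral_congr_ae e1, hI, one_mul,
      setIntegral_eq_integral_of_forall_compl_eq_zero fun y hy => by simp [hκ0 _ (hout y hy)],
      setIntegral_eq_integral_of_forall_compl_eq_zero fun y hy => by simp [hΨ0 _ (hout y hy)]] at he
    refine ⟨?_, ?_, he⟩
    · refine (integrableOn_iff_integrable_of_support_subset fun y hy => ?_).1 (i1.congr e1)
      by_contra h
      exact hy (by simp [hκ0 _ (hout y h)])
    · refine (integrableOn_iff_integrable_of_support_subset fun y hy => ?_).1 i2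
      by_contra h
      exact hy (by simp [hΨ0 _ (hout y h)])

end Mollifier

section Harmonic

variable {d : ℕ} {u l : EuclideanSpace ℝ (Fin (d + 1)) → ℝ}

theorem harmonicAt_green (hd : 1 ≤ d) {y z : EuclideanSpace ℝ (Fin (d + 1))}
    (hy : y ∈ halfSpace d) (hz : z ∈ halfSpace d) (h : z ≠ y) :
    InnerProductSpace.HarmonicAt (green y) z := by
  obtain ⟨K, hK⟩ := exists_isGreenLike_green hd hy one_pos
  exact hK.harmonicAt (by omega) hz h

/-- The difference `l` of `u` and the Green potential of `-Δ u` has the mean value property. After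
subtracting a compactly supported function that equals `u` near `x`, it is the Green potential of a
density vanishing near `x`, and the Green functions with poles off a ball have the mean value
property on that ball. -/
theorem integral_kernel_mul_eq (hd : 1 ≤ d) (hu : ContDiffOn ℝ 2 u (halfSpace d))
    (hl : ∀ x ∈ halfSpace d,
      IntegrableOn (fun y => green x y * -Laplacian.laplacian u y) (halfSpace d) ∧
      u x = l x + ∫ y in halfSpace d, green x y * -Laplacian.laplacian u y)
    {κ Ψ : EuclideanSpace ℝ (Fin (d + 1)) → ℝ} {r : ℝ} (hr : 0 < r)
    (hκc : Continuous κ) (hκ : ∀ z, 0 ≤ κ z) (hκr : ∀ z, r < ‖z‖ → κ z = 0)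
    (hΨr : ∀ z, r < ‖z‖ → Ψ z = 0)
    (hmean : ∀ (x : EuclideanSpace ℝ (Fin (d + 1))) (V : Set (EuclideanSpace ℝ (Fin (d + 1)))),
      IsOpen V → Metric.closedBall x r ⊆ V → ∀ u : EuclideanSpace ℝ (Fin (d + 1)) → ℝ,
        ContDiffOn ℝ 2 u V → Integrable (fun y => κ (y - x) * u y) ∧
          Integrable (fun y => Ψ (y - x) * Laplacian.laplacian u y) ∧
          ∫ y, κ (y - x) * u y = u x + ∫ y, Ψ (y - x) * Laplacian.laplacian u y)
    {x : EuclideanSpace ℝ (Fin (d + 1))} (hx : Metric.closedBall x (2 * r) ⊆ halfSpace d) :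
    Integrable (fun z => κ (z - x) * l z) ∧ ∫ z, κ (z - x) * l z = l x := by
  have hn : 2 ≤ d + 1 := by omega
  have hxH : x ∈ halfSpace d := hx (Metric.mem_closedBall_self (by positivity))
  obtain ⟨v, hv, hvc, hvV, hvu⟩ := exists_contDiff_hasCompactSupport_eventuallyEq
    (isCompact_closedBall x (2 * r)) isOpen_halfSpace hx hu
  let f : EuclideanSpace ℝ (Fin (d + 1)) → ℝ :=
    fun y => Laplacian.laplacian u y - Laplacian.laplacian v y
  have hf0 : ∀ y ∈ Metric.closedBall x (2 * r), f y = 0 := fun y hy => by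
    simp only [f]
    rw [(InnerProductSpace.laplacian_congr_nhds (hvu y hy)).self_of_nhds, sub_self]
  -- `f = Δ (u - v)` vanishes near `x`, and the Green potential of `-Δ v` is `v`
  have hlf : ∀ z ∈ Metric.closedBall x (2 * r),
      IntegrableOn (fun y => green z y * f y) (halfSpace d) ∧
      l z = ∫ y in halfSpace d, green z y * f y := by
    intro z hz
    obtain ⟨K, hK⟩ := exists_isGreenLike_green hd (hx hz) one_pos
    obtain ⟨i1, e1⟩ := hK.integral_mul_laplacian hn hv hvc hvV
    obtain ⟨i2, e2⟩ := hl z (hx hz)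
    have e3 : ∫ y in halfSpace d, green z y * Laplacian.laplacian v y = -u z := by
      rw [setIntegral_eq_integral_of_forall_compl_eq_zero, e1, (hvu z hz).self_of_nhds]
      intro y hy
      rw [laplacian_eq_zero_of_notMem_tsupport fun h => hy (hvV h), mul_zero]
    have e4 : (fun y => green z y * f y) = fun y => -(green z y * -Laplacian.laplacian u y)
        - green z y * Laplacian.laplacian v y := by
      ext y
      simp only [f]
      ring
    have i3 : IntegrableOn (fun y => -(green z y * -Laplacian.laplacian u y)) (halfSpace d) :=
      i2.neg
    rw [e4]
    refine ⟨i3.sub i1.integrableOn, ?_⟩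
    rw [integral_sub i3 i1.integrableOn, integral_neg, e3]
    linarith
  have hball : ∀ z, κ (z - x) ≠ 0 → z ∈ Metric.closedBall x r := fun z hz => by
    rw [Metric.mem_closedBall, dist_eq_norm]
    exact le_of_not_gt fun h => hz (hκr _ h)
  have hrr : Metric.closedBall x r ⊆ Metric.closedBall x (2 * r) :=
    Metric.closedBall_subset_closedBall (by linarith)
  -- the mean value property of the Green functions with poles off the ball
  have hG : ∀ y ∈ halfSpace d, y ∉ Metric.closedBall x (2 * r) →
      Integrable (fun z => κ (z - x) * green z y) ∧
        ∫ z, κ (z - x) * green z y = green x y := by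
    intro y hy hyb
    have hz : ∀ z ∈ Metric.ball x (2 * r), InnerProductSpace.HarmonicAt (green y) z := fun z hz =>
      harmonicAt_green hd hy (hx (Metric.ball_subset_closedBall hz))
        fun h => hyb (h ▸ Metric.ball_subset_closedBall hz)
    have hsub : Metric.closedBall x r ⊆ Metric.ball x (2 * r) :=
      Metric.closedBall_subset_ball (by linarith)
    obtain ⟨i1, -, e1⟩ := hmean x _ Metric.isOpen_ball hsub (green y)
      fun z h => (hz z h).1.contDiffWithinAt
    have e2 : ∫ z, Ψ (z - x) * Laplacian.laplacian (green y) z = 0 := by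
      refine integral_eq_zero_of_ae (.of_forall fun z => ?_)
      by_cases h : r < ‖z - x‖
      · simp [hΨr _ h]
      · have : z ∈ Metric.closedBall x r := by
          rw [Metric.mem_closedBall, dist_eq_norm]
          exact le_of_not_gt h
        simp [(hz z (hsub this)).2.self_of_nhds]
    rw [e2, add_zero] at e1
    simp only [green_comm hd y] at i1 e1
    exact ⟨i1, e1⟩
  let F : EuclideanSpace ℝ (Fin (d + 1)) × EuclideanSpace ℝ (Fin (d + 1)) → ℝ :=
    fun p => κ (p.1 - x) * green p.1 p.2 * f p.2
  have hΔv : Continuous (Laplacian.laplacian v) := by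
    rw [← continuousOn_univ]
    exact continuousOn_laplacian isOpen_univ hv.contDiffOn
  have hfm : AEStronglyMeasurable f (volume.restrict (halfSpace d)) :=
    ((continuousOn_laplacian isOpen_halfSpace hu).sub
      hΔv.continuousOn).aestronglyMeasurable isOpen_halfSpace.measurableSet
  have hFm : AEStronglyMeasurable F (volume.prod (volume.restrict (halfSpace d))) := by
    have h1 : Measurable fun p : EuclideanSpace ℝ (Fin (d + 1)) × EuclideanSpace ℝ (Fin (d + 1)) =>
        κ (p.1 - x) * green p.1 p.2 :=
      (hκc.measurable.comp (measurable_fst.sub_const x)).mul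
        (measurable_green measurable_fst measurable_snd)
    exact h1.aestronglyMeasurable.mul hfm.comp_snd
  -- the absolute value is kept by averaging over `z`, because `κ` and the Green function are
  -- nonnegative; hence integrability of `green x * f` gives integrability of `F`
  have hslice : ∀ y ∈ halfSpace d, Integrable (fun z => F (z, y)) ∧
      ∫ z, F (z, y) = green x y * f y ∧ ∫ z, ‖F (z, y)‖ = ‖green x y * f y‖ := by
    intro y hy
    by_cases hyb : y ∈ Metric.closedBall x (2 * r)
    · simp [F, hf0 y hyb]
    · obtain ⟨i1, e1⟩ := hG y hy hyb
      have hpos : ∀ z, 0 ≤ κ (z - x) * green z y := by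
        intro z
        by_cases h : κ (z - x) = 0
        · simp [h]
        · have hz := hrr (hball z h)
          exact mul_nonneg (hκ _) (green_pos hd (hx hz) hy fun h' => hyb (h' ▸ hz)).le
      have hgx : 0 ≤ green x y := e1 ▸ integral_nonneg hpos
      have i2 : Integrable fun z => F (z, y) := i1.mul_const (f y)
      refine ⟨i2, ?_, ?_⟩
      · simp only [F]
        rw [integral_mul_const, e1]
      · simp only [F, norm_mul (_ * _) (f y), Real.norm_of_nonneg (hpos _)]
        rw [integral_mul_const, e1, norm_mul, Real.norm_of_nonneg hgx]
  have hx2 := hlf x (Metric.mem_closedBall_self (by positivity))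
  have hFi : Integrable F (volume.prod (volume.restrict (halfSpace d))) := by
    rw [integrable_prod_iff' hFm]
    constructor
    · filter_upwards [ae_restrict_mem isOpen_halfSpace.measurableSet] with y hy
      exact (hslice y hy).1
    · refine (Integrable.norm hx2.1).congr ?_
      filter_upwards [ae_restrict_mem isOpen_halfSpace.measurableSet] with y hy
      exact (hslice y hy).2.2.symm
  have hinner : ∀ z, ∫ y in halfSpace d, F (z, y) = κ (z - x) * l z := by
    intro z
    simp only [F, mul_assoc]
    rw [integral_const_mul]
    by_cases h : κ (z - x) = 0
    · simp [h]
    · rw [(hlf z (hrr (hball z h))).2]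
  constructor
  · exact hFi.integral_prod_left.congr (.of_forall hinner)
  · rw [← integral_congr_ae (.of_forall hinner),
      integral_integral_swap (f := fun z y => F (z, y)) hFi, hx2.2]
    refine integral_congr_ae ?_
    filter_upwards [ae_restrict_mem isOpen_halfSpace.measurableSet] with y hy
    exact (hslice y hy).2.1

theorem exists_closedBall_subset_halfSpace {x : EuclideanSpace ℝ (Fin (d + 1))}
    (hx : x ∈ halfSpace d) : ∃ r > 0, Metric.closedBall x r ⊆ halfSpace d :=
  Metric.nhds_basis_closedBall.mem_iff.1 (isOpen_halfSpace.mem_nhds hx)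

/-- The difference of `u` and the Green potential of `-Δ u` is harmonic. -/
theorem harmonicOnNhd_of_greenPotential (hd : 1 ≤ d) (hu : ContDiffOn ℝ 2 u (halfSpace d))
    (hl : ∀ x ∈ halfSpace d,
      IntegrableOn (fun y => green x y * -Laplacian.laplacian u y) (halfSpace d) ∧
      u x = l x + ∫ y in halfSpace d, green x y * -Laplacian.laplacian u y) :
    InnerProductSpace.HarmonicOnNhd l (halfSpace d) := by
  have hn : 2 ≤ d + 1 := by omega
  -- `l` is locally integrable: near `z` it is integrable against a kernel that is nonzero at `z`
  have hint : ∀ z ∈ halfSpace d, ∃ s > 0, Metric.closedBall z s ⊆ halfSpace d ∧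
      IntegrableOn l (Metric.closedBall z s) := by
    intro z hz
    obtain ⟨ρ, hρ, hρH⟩ := exists_closedBall_subset_halfSpace hz
    have hr : 0 < ρ / 3 := by positivity
    obtain ⟨κ, Ψ, hκc, hκ, hκr, -, hΨr, -, hmean⟩ := exists_meanValue_kernel hn hr
    obtain ⟨ζ, hζ⟩ : ∃ ζ, κ ζ ≠ 0 := by
      by_contra! h
      have := (hmean 0 Set.univ isOpen_univ (Set.subset_univ _) (fun _ => 1) contDiffOn_const).2.2
      simp [h] at this
    have hζr : ‖ζ‖ ≤ ρ / 3 := le_of_not_gt fun h => hζ (hκr _ h)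
    have hsub : Metric.closedBall (z - ζ) (2 * (ρ / 3)) ⊆ Metric.closedBall z ρ := by
      refine Metric.closedBall_subset_closedBall' ?_
      rw [dist_eq_norm, sub_sub_cancel_left, norm_neg]
      linarith
    obtain ⟨i1, -⟩ := integral_kernel_mul_eq hd hu hl hr hκc.continuous hκ hκr hΨr hmean
      (hsub.trans hρH)
    have hcont : Continuous fun y => κ (y - (z - ζ)) := by
      have := hκc.continuous
      fun_prop
    have hev : ∀ᶠ y in 𝓝 z, κ (y - (z - ζ)) ≠ 0 :=
      hcont.continuousAt.eventually_ne (by simpa using hζ)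
    obtain ⟨s, hs, hsκ⟩ := Metric.nhds_basis_closedBall.eventually_iff.1
      (hev.and (isOpen_halfSpace.mem_nhds hz))
    refine ⟨s, hs, fun y hy => (hsκ hy).2, ?_⟩
    have h1 := IntegrableOn.continuousOn_mul
      (hcont.continuousOn.inv₀ fun y hy => (hsκ hy).1 :
        ContinuousOn (fun y => (κ (y - (z - ζ)))⁻¹) (Metric.closedBall z s))
      i1.integrableOn (isCompact_closedBall z s)
    refine h1.congr_fun (fun y hy => ?_) measurableSet_closedBall
    exact inv_mul_cancel_left₀ (hsκ hy).1 _
  -- `l` is smooth: by the mean value property it is locally a convolution with a smooth kernel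
  have hsmooth : ContDiffOn ℝ 2 l (halfSpace d) := by
    intro z hz
    obtain ⟨s, hs, hsH, hsi⟩ := hint z hz
    have hr : 0 < s / 4 := by positivity
    obtain ⟨κ, Ψ, hκc, hκ, hκr, -, hΨr, -, hmean⟩ := exists_meanValue_kernel hn hr
    have hcs : HasCompactSupport fun y => κ (-y) := by
      refine HasCompactSupport.intro (isCompact_closedBall 0 (s / 4)) fun y hy => hκr _ ?_
      rw [norm_neg]
      simpa using hy
    have hconv := hcs.contDiff_convolution_right (n := 2) (ContinuousLinearMap.mul ℝ ℝ)
      (hsi.integrable_indicator measurableSet_closedBall).locallyIntegrable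
      (hκc.comp contDiff_neg)
    refine (hconv.contDiffAt.congr_of_eventuallyEq ?_).contDiffWithinAt
    filter_upwards [Metric.ball_mem_nhds z (half_pos hs)] with x hx
    have hxs : Metric.closedBall x (s / 2) ⊆ Metric.closedBall z s :=
      Metric.closedBall_subset_closedBall' (by linarith [Metric.mem_ball.1 hx])
    have h2 := (integral_kernel_mul_eq hd hu hl hr hκc.continuous hκ hκr hΨr hmean (x := x)
      (by rw [show 2 * (s / 4) = s / 2 by ring]; exact hxs.trans hsH)).2
    rw [← h2, convolution_def]
    refine integral_congr_ae (.of_forall fun y => ?_)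
    simp only [ContinuousLinearMap.mul_apply', neg_sub]
    by_cases hy : y ∈ Metric.closedBall z s
    · rw [Set.indicator_of_mem hy, mul_comm]
    · have : κ (y - x) = 0 := hκr _ (by
        rw [← dist_eq_norm]
        exact lt_of_not_ge fun h => hy (hxs (Metric.closedBall_subset_closedBall (by linarith) h)))
      simp [this]
  -- a nonzero `Δ l x` would keep its sign near `x`, so the error term of the mean value formula on
  -- a small ball could not vanish
  have hΔ : ∀ x ∈ halfSpace d, Laplacian.laplacian l x = 0 := by
    intro x hx
    by_contra hne
    set δ := Laplacian.laplacian l x with hδ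
    have hcont := (continuousOn_laplacian isOpen_halfSpace hsmooth).continuousAt
      (isOpen_halfSpace.mem_nhds hx)
    have hev : ∀ᶠ y in 𝓝 x, 0 < δ * Laplacian.laplacian l y :=
      (hcont.const_mul δ).eventually (lt_mem_nhds (mul_self_pos.2 hne))
    obtain ⟨ρ, hρ, hρs⟩ := Metric.nhds_basis_closedBall.eventually_iff.1
      (hev.and (isOpen_halfSpace.mem_nhds hx))
    have hr : 0 < ρ / 2 := by positivity
    obtain ⟨κ, Ψ, hκc, hκ, hκr, hΨ, hΨr, hΨpos, hmean⟩ := exists_meanValue_kernel hn hr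
    have hH : Metric.closedBall x (2 * (ρ / 2)) ⊆ halfSpace d := by
      rw [mul_div_cancel₀ _ two_ne_zero]
      exact fun y hy => (hρs hy).2
    have h1 := (integral_kernel_mul_eq hd hu hl hr hκc.continuous hκ hκr hΨr hmean hH).2
    obtain ⟨-, i2, e2⟩ := hmean x _ isOpen_halfSpace
      ((Metric.closedBall_subset_closedBall (by linarith)).trans hH) l hsmooth
    rw [h1, left_eq_add] at e2
    have h3 : 0 ≤ fun y => δ * (Ψ (y - x) * Laplacian.laplacian l y) := by
      intro y
      by_cases hy : y ∈ Metric.closedBall x ρ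
      · have := mul_nonneg (hΨ (y - x)) (hρs hy).1.le
        simp only [Pi.zero_apply]
        linarith
      · have : Ψ (y - x) = 0 := hΨr _ (by
          rw [← dist_eq_norm]
          exact lt_of_not_ge fun h => hy
            (Metric.closedBall_subset_closedBall (by linarith) (Metric.mem_closedBall.2 h)))
        simp [this]
    have h4 : ∫ y, δ * (Ψ (y - x) * Laplacian.laplacian l y) = 0 := by
      rw [integral_const_mul, e2, mul_zero]
    rw [integral_eq_zero_iff_of_nonneg h3 (i2.const_mul δ)] at h4
    have hΨx : ∀ᶠ y in 𝓝[≠] x, 0 < Ψ (y - x) := by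
      rw [eventually_nhdsWithin_iff] at hΨpos ⊢
      have ht : Tendsto (fun y => y - x) (𝓝 x) (𝓝 0) := by
        have : Continuous fun y => y - x := by fun_prop
        simpa using this.tendsto x
      filter_upwards [ht.eventually hΨpos] with y hy hyx
      exact hy (sub_ne_zero.2 hyx)
    rw [eventually_nhdsWithin_iff] at hΨx
    obtain ⟨t, ht, hts⟩ := Metric.nhds_basis_ball.eventually_iff.1 (hΨx.and hev)
    have hzero : ∀ᵐ y, y ∉ Metric.ball x t := by
      have hae : ∀ᵐ y : EuclideanSpace ℝ (Fin (d + 1)), y ≠ x := by simp [ae_iff]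
      filter_upwards [h4, hae] with y hy hyx hyt
      have := mul_pos ((hts hyt).1 hyx) (hts hyt).2
      simp only [Pi.zero_apply] at hy
      linarith
    have := Metric.measure_ball_pos volume x ht
    rw [ae_iff] at hzero
    simp only [not_not, Set.ofPred_mem_eq] at hzero
    exact this.ne' hzero
  intro x hx
  refine ⟨hsmooth.contDiffAt (isOpen_halfSpace.mem_nhds hx), ?_⟩
  filter_upwards [isOpen_halfSpace.mem_nhds hx] with y hy using hΔ y hy

end Harmonic

/-! ### Gradient bounds and the ring limit -/

section GradientBounds

variable {d : ℕ} {x y : EuclideanSpace ℝ (Fin (d + 1))}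

theorem gradient_green (hd : 1 ≤ d) (hx : x ∈ halfSpace d) (hy : y ∈ halfSpace d) (h : y ≠ x) :
    ∇ (green x) y = -(2 * fluxConst (d + 1)) •
      ((‖y - x‖ ^ 2) ^ (-((d + 1 : ℕ) : ℝ) / 2) • (y - x)
        - (‖y - reflect x‖ ^ 2) ^ (-((d + 1 : ℕ) : ℝ) / 2) • (y - reflect x)) := by
  have hn : 2 ≤ d + 1 := by omega
  have h1 := (hasGradientAt_fundSol hn h).hasFDerivAt
  have h2 := (hasGradientAt_fundSol hn
    (ne_of_mem_of_not_mem hy (reflect_notMem_halfSpace hx))).hasFDerivAt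
  have h3 : HasGradientAt (green x) _ y := (h1.sub h2).hasGradientAt
  rw [h3.gradient, map_sub, LinearIsometryEquiv.symm_apply_apply,
    LinearIsometryEquiv.symm_apply_apply]
  module

theorem norm_smul_sub_smul_sq (α β : ℝ) (p q : EuclideanSpace ℝ (Fin (d + 1))) :
    ‖α • p - β • q‖ ^ 2
      = (α - β) * (α * ‖p‖ ^ 2 - β * ‖q‖ ^ 2) + ‖q - p‖ ^ 2 * (α * β) := by
  have h1 := norm_sub_sq_real (α • p) (β • q)
  have h2 := norm_sub_sq_real q p
  rw [real_inner_smul_left, real_inner_smul_right, norm_smul, norm_smul, mul_pow, mul_pow,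
    Real.norm_eq_abs, Real.norm_eq_abs, sq_abs, sq_abs] at h1
  rw [real_inner_comm] at h2
  rw [h1, h2]
  ring

theorem sq_rpow_neg_half_sq (n : ℕ) {r : ℝ} (hr : 0 < r) :
    ((r ^ 2) ^ (-(n : ℝ) / 2)) ^ 2 = 1 / r ^ (2 * n) := by
  rw [← Real.rpow_natCast _ 2, ← Real.rpow_mul (by positivity), one_div, pow_mul,
    ← Real.rpow_natCast _ n, ← Real.rpow_neg (by positivity)]
  congr 1
  push_cast
  ring

theorem norm_sub_reflect_self (hx : x ∈ halfSpace d) :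
    ‖x - reflect x‖ = 2 * x (Fin.last d) := by
  have h := norm_sub_reflect_sq x x
  rw [sub_self, norm_zero] at h
  have h0 : 0 < x (Fin.last d) := hx
  exact (sq_eq_sq₀ (norm_nonneg _) (by positivity)).1 (by linarith)

/-- Upper gradient bound: by Bernoulli's inequality the two terms of the gradient differ by a
multiple of `‖y - x‖ ^ (-N)`. -/
theorem exists_norm_gradient_green_sq_le (hd : 1 ≤ d) (hx : x ∈ halfSpace d) :
    ∃ C > 0, ∀ y ∈ halfSpace d, y ≠ x →
      ‖∇ (green x) y‖ ^ 2 ≤ C * (1 / ‖x - y‖ ^ (2 * (d + 1))) := by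
  have hA := fluxConst_pos (n := d + 1) (by omega)
  have hh : 0 < x (Fin.last d) := hx
  set h := x (Fin.last d)
  set n : ℝ := ((d + 1 : ℕ) : ℝ) with hn
  have hn2 : 2 ≤ n := by
    rw [hn]
    exact_mod_cast (by omega : 2 ≤ d + 1)
  refine ⟨(2 * fluxConst (d + 1) * (2 * h + 2 * n * h)) ^ 2, by positivity, fun y hy hyx => ?_⟩
  have hy0 : 0 < y (Fin.last d) := hy
  have ha := norm_pos_iff.2 (sub_ne_zero.2 hyx)
  have hab := norm_sub_reflect_sq x y
  rw [norm_sub_rev x y, ← sq_rpow_neg_half_sq (d + 1) ha, gradient_green hd hx hy hyx, norm_smul,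
    ← hn, ← mul_pow]
  have hδ : 0 < 4 * h * y (Fin.last d) := by positivity
  have hqp : ‖(y - reflect x) - (y - x)‖ = 2 * h := by
    rw [sub_sub_sub_cancel_left, norm_sub_reflect_self hx]
  have hb : 0 < ‖y - reflect x‖ := by
    by_contra hb
    have : ‖y - reflect x‖ = 0 := le_antisymm (not_lt.1 hb) (norm_nonneg _)
    rw [this] at hab
    nlinarith
  have htri : ‖y - reflect x‖ - ‖y - x‖ ≤ 2 * h := hqp ▸ norm_sub_norm_le _ _
  set a := ‖y - x‖
  set b := ‖y - reflect x‖
  set α := (a ^ 2) ^ (-n / 2) with hα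
  set β := (b ^ 2) ^ (-n / 2) with hβ
  have hα0 : 0 < α := by positivity
  have hba : a ≤ b := by
    refine (pow_le_pow_iff_left₀ ha.le hb.le two_ne_zero).1 ?_
    linarith
  have hβα : β ≤ α := Real.rpow_le_rpow_of_nonpos (by positivity) (by gcongr) (by linarith)
  have hbern : (α - β) * b ≤ 2 * n * h * α := by
    have h1 := one_add_mul_self_le_rpow_one_add (s := a ^ 2 / b ^ 2 - 1) (p := n / 2)
      (by have : 0 ≤ a ^ 2 / b ^ 2 := by positivity
          linarith) (by linarith)
    have h2 : (1 + (a ^ 2 / b ^ 2 - 1)) ^ (n / 2) = β / α := by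
      rw [add_sub_cancel, Real.div_rpow (by positivity) (by positivity), hα, hβ, neg_div,
        Real.rpow_neg (by positivity), Real.rpow_neg (by positivity), inv_div_inv]
    rw [h2, le_div_iff₀ hα0] at h1
    have h3 : (α - β) * b ≤ n / 2 * ((b - a) * ((b + a) / b)) * α := by
      have h4 : n / 2 * ((b - a) * ((b + a) / b)) * α
          = (α - (1 + n / 2 * (a ^ 2 / b ^ 2 - 1)) * α) * b := by
        field_simp
        ring
      rw [h4]
      gcongr
    have h5 : (b + a) / b ≤ 2 := by
      rw [div_le_iff₀ hb]
      linarith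
    calc (α - β) * b ≤ n / 2 * ((b - a) * ((b + a) / b)) * α := h3
      _ ≤ n / 2 * (2 * h * 2) * α := by
          have : 0 ≤ b - a := sub_nonneg.2 hba
          gcongr
      _ = 2 * n * h * α := by ring
  have hnorm : ‖α • (y - x) - β • (y - reflect x)‖ ≤ (2 * h + 2 * n * h) * α := by
    have e : α • (y - x) - β • (y - reflect x)
        = -(α • ((y - reflect x) - (y - x))) + (α - β) • (y - reflect x) := by
      module
    rw [e]
    refine (norm_add_le _ _).trans ?_
    rw [norm_neg, norm_smul, norm_smul, hqp, Real.norm_of_nonneg hα0.le,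
      Real.norm_of_nonneg (sub_nonneg.2 hβα)]
    linarith
  rw [norm_neg, Real.norm_of_nonneg (by positivity)]
  refine pow_le_pow_left₀ (by positivity) ?_ 2
  rw [mul_assoc (2 * fluxConst (d + 1))]
  gcongr

/-- The lower bound for the gradient away from the pole. By `norm_smul_sub_smul_sq` the squared norm
is a sum of two nonnegative terms, and the one kept here does not degenerate at the boundary. -/
theorem exists_le_norm_gradient_green_sq (hd : 1 ≤ d) (hx : x ∈ halfSpace d) {δ : ℝ}
    (hδ : 0 < δ) : ∃ c > 0, ∀ y ∈ halfSpace d, δ ≤ ‖y - x‖ →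
      c * (1 / ‖x - y‖ ^ (2 * (d + 1))) ≤ ‖∇ (green x) y‖ ^ 2 := by
  have hA := fluxConst_pos (n := d + 1) (by omega)
  have hh : 0 < x (Fin.last d) := hx
  set h := x (Fin.last d)
  set n : ℝ := ((d + 1 : ℕ) : ℝ) with hn
  have hn2 : 2 ≤ n := by
    rw [hn]
    exact_mod_cast (by omega : 2 ≤ d + 1)
  set M : ℝ := ((1 + 2 * h / δ) ^ 2) ^ (-n / 2) with hM
  have hM0 : 0 < M := by positivity
  refine ⟨(2 * fluxConst (d + 1)) ^ 2 * ((2 * h) ^ 2 * M), by positivity, fun y hy hyδ => ?_⟩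
  have hy0 : 0 < y (Fin.last d) := hy
  have ha : 0 < ‖y - x‖ := hδ.trans_le hyδ
  have hyx : y ≠ x := sub_ne_zero.1 (norm_pos_iff.1 ha)
  have hab := norm_sub_reflect_sq x y
  rw [norm_sub_rev x y, ← sq_rpow_neg_half_sq (d + 1) ha, gradient_green hd hx hy hyx, norm_smul,
    mul_pow ‖-(2 * fluxConst (d + 1))‖, norm_smul_sub_smul_sq, ← hn]
  have hqp : ‖(y - reflect x) - (y - x)‖ = 2 * h := by
    rw [sub_sub_sub_cancel_left, norm_sub_reflect_self hx]
  have hpos : 0 < 4 * h * y (Fin.last d) := by positivity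
  have htri : ‖y - reflect x‖ ≤ ‖y - x‖ + 2 * h := by
    have := norm_sub_norm_le (y - reflect x) (y - x)
    rw [hqp] at this
    linarith
  have hb2 : 0 < ‖y - reflect x‖ ^ 2 := by
    rw [hab]
    positivity
  rw [hqp]
  have hb0 := norm_nonneg (y - reflect x)
  set a := ‖y - x‖
  set b := ‖y - reflect x‖
  have hba : a ^ 2 ≤ b ^ 2 := by linarith
  set α := (a ^ 2) ^ (-n / 2) with hα
  set β := (b ^ 2) ^ (-n / 2) with hβ
  have hα0 : 0 < α := by positivity
  have hβα : β ≤ α := Real.rpow_le_rpow_of_nonpos (by positivity) hba (by linarith)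
  have h1 : β * b ^ 2 ≤ α * a ^ 2 := by
    rw [hα, hβ, ← Real.rpow_add_one (by positivity), ← Real.rpow_add_one (by positivity)]
    exact Real.rpow_le_rpow_of_nonpos (by positivity) hba (by linarith)
  have h2 : M * α ≤ β := by
    rw [hM, hα, hβ, ← Real.mul_rpow (by positivity) (by positivity)]
    refine Real.rpow_le_rpow_of_nonpos hb2 ?_ (by linarith)
    rw [← mul_pow]
    refine pow_le_pow_left₀ hb0 (htri.trans ?_) 2
    have : 2 * h ≤ 2 * h / δ * a := by
      rw [div_mul_eq_mul_div, le_div_iff₀ hδ]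
      gcongr
    linarith
  rw [norm_neg, Real.norm_of_nonneg (by positivity : (0 : ℝ) ≤ 2 * fluxConst (d + 1)), mul_assoc]
  gcongr
  calc (2 * h) ^ 2 * M * α ^ 2 = (2 * h) ^ 2 * (α * (M * α)) := by ring
    _ ≤ (2 * h) ^ 2 * (α * β) := by gcongr
    _ ≤ (α - β) * (α * a ^ 2 - β * b ^ 2) + (2 * h) ^ 2 * (α * β) :=
        le_add_of_nonneg_left (mul_nonneg (sub_nonneg.2 hβα) (sub_nonneg.2 h1))

end GradientBounds

section Liminf

variable {d : ℕ} {x : EuclideanSpace ℝ (Fin (d + 1))} {u μ : EuclideanSpace ℝ (Fin (d + 1)) → ℝ}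

theorem liminf_coe_eq_zero_iff {f : ℝ → ℝ} (hf : ∀ᶠ R in atTop, 0 ≤ f R) :
    liminf (fun R : ℝ => ((f R : ℝ) : EReal)) atTop = 0
      ↔ ∀ ε : ℝ, 0 < ε → ∃ᶠ R in atTop, f R < ε := by
  constructor
  · intro h ε hε
    have : liminf (fun R : ℝ => ((f R : ℝ) : EReal)) atTop < (ε : EReal) := by
      rw [h]
      exact_mod_cast hε
    exact (frequently_lt_of_liminf_lt (by isBoundedDefault) this).mono fun R hR => by
      exact_mod_cast hR
  · intro h
    refine le_antisymm (le_of_not_gt fun hlt => ?_) ?_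
    · obtain ⟨ε, h1, h2⟩ := EReal.lt_iff_exists_real_btwn.1 hlt
      have h3 := liminf_le_of_frequently_le' (u := fun R : ℝ => ((f R : ℝ) : EReal))
        (x := (ε : EReal)) ((h ε (by exact_mod_cast h1)).mono fun R hR => by exact_mod_cast hR.le)
      exact absurd h2 h3.not_gt
    · exact le_liminf_of_le (by isBoundedDefault) (hf.mono fun R hR => by exact_mod_cast hR)

theorem ringLiminf_eq_of_tendsto {L : ℝ}
    (h : Tendsto (ringIntegral u x) atTop (𝓝 (Real.log 2 * L))) :
    ringLiminf u x = (L : EReal) := by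
  have hlog : Real.log 2 ≠ 0 := (Real.log_pos one_lt_two).ne'
  have h1 : Tendsto (fun R => ((ringIntegral u x R : ℝ) : EReal)) atTop
      (𝓝 ((Real.log 2 * L : ℝ) : EReal)) := EReal.tendsto_coe.2 h
  rw [ringLiminf, h1.liminf_eq, ← EReal.coe_mul]
  congr 1
  field_simp

theorem ringLiminf_eq_bot_of_tendsto (h : Tendsto (ringIntegral u x) atTop atBot) :
    ringLiminf u x = ⊥ := by
  have h1 : Tendsto (fun R => ((ringIntegral u x R : ℝ) : EReal)) atTop (𝓝 ⊥) :=
    EReal.tendsto_coe_nhds_bot_iff.2 h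
  rw [ringLiminf, h1.liminf_eq,
    EReal.coe_mul_bot_of_pos (one_div_pos.2 (Real.log_pos one_lt_two))]

theorem greenRep_iff (hμ : ∀ y ∈ halfSpace d, -Laplacian.laplacian u y = μ y) (a c : ℝ) :
    HasGreenRep μ x a c ↔
      IntegrableOn (fun y => green x y * -Laplacian.laplacian u y) (halfSpace d) ∧
      a = c + ∫ y in halfSpace d, green x y * -Laplacian.laplacian u y := by
  have e : Set.EqOn (fun y => green x y * μ y) (fun y => green x y * -Laplacian.laplacian u y)
      (halfSpace d) := fun y hy => by simp only [hμ y hy]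
  rw [HasGreenRep, integrableOn_congr_fun e isOpen_halfSpace.measurableSet,
    setIntegral_congr_fun isOpen_halfSpace.measurableSet e]

/-- The ring limit is the real number `c` exactly when `u(x)` is `c` plus a finite potential. -/
theorem ringLiminf_eq_coe_iff (hd : 1 ≤ d) (hx : x ∈ halfSpace d)
    (hu : ContDiffOn ℝ 2 u (halfSpace d))
    (hμ : ∀ y ∈ halfSpace d, -Laplacian.laplacian u y = μ y)
    (hμ0 : ∀ y ∈ halfSpace d, 0 ≤ μ y) (c : ℝ) :
    ringLiminf u x = (c : EReal) ↔ HasGreenRep μ x (u x) c := by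
  have hΔ : ∀ y ∈ halfSpace d, Laplacian.laplacian u y ≤ 0 := fun y hy => by
    linarith [hμ y hy, hμ0 y hy]
  obtain ⟨h1, h2⟩ := tendsto_ringIntegral hd hx hu hΔ
  rw [greenRep_iff hμ]
  by_cases hi : IntegrableOn (fun y => green x y * -Laplacian.laplacian u y) (halfSpace d)
  · rw [ringLiminf_eq_of_tendsto (h1 hi), EReal.coe_eq_coe_iff, sub_eq_iff_eq_add]
    exact ⟨fun h => ⟨hi, h⟩, fun h => h.2⟩
  · rw [ringLiminf_eq_bot_of_tendsto (h2 hi)]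
    exact ⟨fun h => absurd h (EReal.bot_ne_coe c), fun h => absurd h.1 hi⟩

theorem ringIntegral_sub_const (hd : 1 ≤ d) (hx : x ∈ halfSpace d) {R : ℝ} (hR : 0 < R)
    (hu : ContDiffOn ℝ 2 u (halfSpace d)) (c : ℝ) :
    ringIntegral (fun y => u y - c) x R = ringIntegral u x R - Real.log 2 * c := by
  obtain ⟨i1, -, -⟩ := ringIntegral_eq hd hx hR hu
  obtain ⟨i2, -, e2⟩ := ringIntegral_eq hd hx hR (u := fun _ => c) contDiffOn_const
  have e3 : ringIntegral (fun _ => c) x R = Real.log 2 * c := by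
    rw [e2]
    simp
  rw [← e3, ringIntegral, ringIntegral, ringIntegral, ← integral_sub i1 i2]
  refine integral_congr_ae (.of_forall fun y => ?_)
  simp only [mul_sub]

theorem weight_nonneg (hd : 1 ≤ d) (hx : x ∈ halfSpace d) {R : ℝ}
    {y : EuclideanSpace ℝ (Fin (d + 1))} (hy : y ∈ greenRing x R) :
    0 ≤ ‖∇ (green x) y‖ ^ 2 / green x y := by
  obtain ⟨h1, h2, -⟩ := mem_greenRing.1 hy
  exact div_nonneg (by positivity) (green_pos hd hx h1 h2).le

theorem abs_ringIntegral_sub_le (hd : 1 ≤ d) (hx : x ∈ halfSpace d) {R : ℝ} (hR : 0 < R)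
    (hu : ContDiffOn ℝ 2 u (halfSpace d)) (c : ℝ) :
    |ringIntegral u x R - Real.log 2 * c| ≤ ringIntegral (fun y => |u y - c|) x R := by
  rw [← ringIntegral_sub_const hd hx hR hu c]
  refine (norm_integral_le_integral_norm (μ := volume.restrict (greenRing x R))
    fun y => ‖∇ (green x) y‖ ^ 2 / green x y * (u y - c)).trans_eq ?_
  refine setIntegral_congr_fun measurableSet_greenRing fun y hy => ?_
  simp only [norm_mul, Real.norm_of_nonneg (weight_nonneg hd hx hy)]
  rfl

/-- A lower bound of `u` bounds the ring integrals from below. This excludes the ring limit `-∞`,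
and the lower bound passes to the ring limit. -/
theorem exists_le_and_hasGreenRep (hd : 1 ≤ d) (hx : x ∈ halfSpace d)
    (hu : ContDiffOn ℝ 2 u (halfSpace d))
    (hμ : ∀ y ∈ halfSpace d, -Laplacian.laplacian u y = μ y)
    (hμ0 : ∀ y ∈ halfSpace d, 0 ≤ μ y) {m : ℝ} (hm : ∀ y ∈ halfSpace d, m ≤ u y) :
    ∃ c, m ≤ c ∧ HasGreenRep μ x (u x) c := by
  have hlog : 0 < Real.log 2 := Real.log_pos one_lt_two
  have hΔ : ∀ y ∈ halfSpace d, Laplacian.laplacian u y ≤ 0 := fun y hy => by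
    linarith [hμ y hy, hμ0 y hy]
  have hge : ∀ R, 0 < R → Real.log 2 * m ≤ ringIntegral u x R := by
    intro R hR
    rw [← sub_nonneg, ← ringIntegral_sub_const hd hx hR hu]
    refine setIntegral_nonneg measurableSet_greenRing fun y hy => ?_
    exact mul_nonneg (weight_nonneg hd hx hy) (sub_nonneg.2 (hm y (mem_greenRing.1 hy).1))
  obtain ⟨h1, h2⟩ := tendsto_ringIntegral hd hx hu hΔ
  by_cases hi : IntegrableOn (fun y => green x y * -Laplacian.laplacian u y) (halfSpace d)
  · refine ⟨_, ?_, (greenRep_iff hμ _ _).2 ⟨hi, (sub_add_cancel _ _).symm⟩⟩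
    refine le_of_mul_le_mul_left (ge_of_tendsto (h1 hi) ?_) hlog
    filter_upwards [eventually_gt_atTop 0] with R hR using hge R hR
  · obtain ⟨R, hR, hlt⟩ := (((eventually_gt_atTop 0).and
      ((h2 hi).eventually (eventually_lt_atBot (Real.log 2 * m))))).exists
    exact absurd hlt (hge R hR).not_gt

theorem ringLiminf_eq_of_liminf_abs (hd : 1 ≤ d) (hx : x ∈ halfSpace d)
    (hu : ContDiffOn ℝ 2 u (halfSpace d))
    (hΔ : ∀ y ∈ halfSpace d, Laplacian.laplacian u y ≤ 0) {c : ℝ}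
    (h : ∀ ε : ℝ, 0 < ε → ∃ᶠ R in atTop, ringIntegral (fun y => |u y - c|) x R < ε) :
    ringLiminf u x = (c : EReal) := by
  obtain ⟨h1, h2⟩ := tendsto_ringIntegral hd hx hu hΔ
  have hfreq : ∀ ε : ℝ, 0 < ε → ∃ᶠ R in atTop, |ringIntegral u x R - Real.log 2 * c| < ε :=
    fun ε hε => ((h ε hε).and_eventually (eventually_gt_atTop 0)).mono fun R hR =>
      (abs_ringIntegral_sub_le hd hx hR.2 hu c).trans_lt hR.1
  by_cases hi : IntegrableOn (fun y => green x y * -Laplacian.laplacian u y) (halfSpace d)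
  · have ht := h1 hi
    refine ringLiminf_eq_of_tendsto ?_
    convert ht using 2
    by_contra hne
    have hpos := abs_pos.2 (sub_ne_zero.2 (Ne.symm hne))
    refine hfreq _ (half_pos hpos) ?_
    filter_upwards [((ht.sub_const (Real.log 2 * c)).abs).eventually
      (lt_mem_nhds (half_lt_self hpos))]
      with R hR using hR.not_gt
  · refine absurd ((h2 hi).eventually (eventually_lt_atBot (Real.log 2 * c - 1))) fun hev => ?_
    refine hfreq 1 one_pos ?_
    filter_upwards [hev] with R hR
    rw [abs_of_neg (by linarith)]
    linarith

/-- The weight `|∇ G^x|² / G^x` and the explicit weight are comparable on large rings. -/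
theorem exists_ringIntegral_comparable (hd : 1 ≤ d) (hx : x ∈ halfSpace d)
    (hu : ContDiffOn ℝ 2 u (halfSpace d)) (c : ℝ) :
    ∃ c₁ > 0, ∃ c₂ > 0, ∀ᶠ R in atTop,
      c₁ * (R * ∫ y in greenRing x R, 1 / ‖x - y‖ ^ (2 * (d + 1)) * |u y - c|)
          ≤ ringIntegral (fun y => |u y - c|) x R ∧
      ringIntegral (fun y => |u y - c|) x R
          ≤ c₂ * (R * ∫ y in greenRing x R, 1 / ‖x - y‖ ^ (2 * (d + 1)) * |u y - c|) := by
  obtain ⟨K, hK⟩ := exists_isGreenLike_green hd hx one_pos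
  have hpole := (hK.tendsto_pole (by omega)).eventually (eventually_gt_atTop 1)
  rw [eventually_nhdsWithin_iff] at hpole
  obtain ⟨δ, hδ, hδG⟩ := Metric.nhds_basis_ball.eventually_iff.1 hpole
  obtain ⟨C, hC, hCle⟩ := exists_norm_gradient_green_sq_le hd hx
  obtain ⟨c₁, hc₁, hc₁le⟩ := exists_le_norm_gradient_green_sq hd hx hδ
  refine ⟨c₁, hc₁, 2 * C, by positivity, ?_⟩
  filter_upwards [eventually_ge_atTop 1] with R hR
  have hR0 : 0 < R := by linarith
  have hpt : ∀ y ∈ greenRing x R,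
      c₁ * (R * (1 / ‖x - y‖ ^ (2 * (d + 1)) * |u y - c|))
        ≤ ‖∇ (green x) y‖ ^ 2 / green x y * |u y - c| ∧
      ‖∇ (green x) y‖ ^ 2 / green x y * |u y - c|
        ≤ 2 * C * (R * (1 / ‖x - y‖ ^ (2 * (d + 1)) * |u y - c|)) := by
    intro y hy
    obtain ⟨hyH, hyx, h1, h2⟩ := mem_greenRing.1 hy
    have hg := green_pos hd hx hyH hyx
    -- on the ring `green x y ≤ 1 / R ≤ 1`, while `green x > 1` on the ball of radius `δ`
    have hyδ : δ ≤ ‖y - x‖ := by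
      by_contra! hlt
      have : 1 < green x y := hδG (by rwa [Metric.mem_ball, dist_eq_norm]) hyx
      have : 1 / R ≤ 1 := (div_le_one hR0).2 hR
      linarith
    have h3 : R ≤ (green x y)⁻¹ := by
      rw [le_inv_comm₀ hR0 hg]
      simpa using h2
    have h4 : (green x y)⁻¹ ≤ 2 * R := by
      rw [inv_le_comm₀ hg (by positivity)]
      simpa [one_div] using h1.le
    have h5 := hc₁le y hyH hyδ
    have h6 := hCle y hyH hyx
    set Z := 1 / ‖x - y‖ ^ (2 * (d + 1))
    have hZ : 0 ≤ Z := by positivity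
    constructor
    · calc c₁ * (R * (Z * |u y - c|)) = (c₁ * Z) * R * |u y - c| := by ring
        _ ≤ ‖∇ (green x) y‖ ^ 2 * (green x y)⁻¹ * |u y - c| := by gcongr
        _ = _ := by rw [div_eq_mul_inv]
    · calc ‖∇ (green x) y‖ ^ 2 / green x y * |u y - c|
          = ‖∇ (green x) y‖ ^ 2 * (green x y)⁻¹ * |u y - c| := by rw [div_eq_mul_inv]
        _ ≤ (C * Z) * (2 * R) * |u y - c| := by gcongr
        _ = _ := by ring
  have hsub : greenRing x R ⊆ halfSpace d := fun y hy => (mem_greenRing.1 hy).1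
  have hi1 : IntegrableOn (fun y => ‖∇ (green x) y‖ ^ 2 / green x y * |u y - c|)
      (greenRing x R) := by
    have := (ringIntegral_eq hd hx hR0 (hu.sub (contDiffOn_const (c := c)))).1
    refine IntegrableOn.congr_fun this.norm (fun y hy => ?_) measurableSet_greenRing
    simp only [norm_mul, Real.norm_of_nonneg (weight_nonneg hd hx hy), Real.norm_eq_abs]
  have hi2 : IntegrableOn (fun y => 1 / ‖x - y‖ ^ (2 * (d + 1)) * |u y - c|) (greenRing x R) := by
    have hm : AEStronglyMeasurable (fun y => 1 / ‖x - y‖ ^ (2 * (d + 1)) * |u y - c|)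
        (volume.restrict (greenRing x R)) := by
      have h1 : Measurable fun y : EuclideanSpace ℝ (Fin (d + 1)) =>
          1 / ‖x - y‖ ^ (2 * (d + 1)) := by fun_prop
      have h2 : ContinuousOn (fun y => |u y - c|) (halfSpace d) :=
        (hu.continuousOn.sub continuousOn_const).abs
      exact h1.aestronglyMeasurable.mul
        ((h2.mono hsub).aestronglyMeasurable measurableSet_greenRing)
    refine (hi1.const_mul (c₁ * R)⁻¹).mono' hm ?_
    filter_upwards [ae_restrict_mem measurableSet_greenRing] with y hy
    rw [Real.norm_of_nonneg (by positivity), ← div_eq_inv_mul, le_div_iff₀ (by positivity)]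
    linarith [(hpt y hy).1]
  rw [ringIntegral, ← integral_const_mul, ← integral_const_mul, ← integral_const_mul]
  exact ⟨setIntegral_mono_on ((hi2.const_mul R).const_mul c₁) hi1 measurableSet_greenRing
      fun y hy => (hpt y hy).1,
    setIntegral_mono_on hi1 ((hi2.const_mul R).const_mul (2 * C)) measurableSet_greenRing
      fun y hy => (hpt y hy).2⟩

theorem liminf_abs_iff (hd : 1 ≤ d) (hx : x ∈ halfSpace d)
    (hu : ContDiffOn ℝ 2 u (halfSpace d)) (c : ℝ) :
    (∀ ε : ℝ, 0 < ε → ∃ᶠ R in atTop, ringIntegral (fun y => |u y - c|) x R < ε) ↔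
      ∀ ε : ℝ, 0 < ε → ∃ᶠ R : ℝ in atTop,
        R * ∫ y in greenRing x R, 1 / ‖x - y‖ ^ (2 * (d + 1)) * |u y - c| < ε := by
  obtain ⟨c₁, h₁, c₂, h₂, hc⟩ := exists_ringIntegral_comparable hd hx hu c
  constructor
  · intro h ε hε
    refine ((h (c₁ * ε) (by positivity)).and_eventually hc).mono fun R hR => ?_
    exact lt_of_mul_lt_mul_left (hR.2.1.trans_lt hR.1) h₁.le
  · intro h ε hε
    refine ((h (ε / c₂) (by positivity)).and_eventually hc).mono fun R hR => ?_
    have := (lt_div_iff₀ h₂).1 hR.1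
    linarith [hR.2.2]

/-- A nonnegative continuous density whose Green potential vanishes at one point is zero. -/
theorem eq_zero_of_integral_green_eq_zero (hd : 1 ≤ d) (hx : x ∈ halfSpace d)
    (hμc : ContinuousOn μ (halfSpace d)) (hμ0 : ∀ y ∈ halfSpace d, 0 ≤ μ y)
    (hi : IntegrableOn (fun y => green x y * μ y) (halfSpace d))
    (h : ∫ y in halfSpace d, green x y * μ y = 0) : ∀ y ∈ halfSpace d, μ y = 0 := by
  have hn : 0 ≤ᵐ[volume.restrict (halfSpace d)] fun y => green x y * μ y := by
    filter_upwards [ae_mem_halfSpace_ne (x := x)] with y hy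
    exact mul_nonneg (green_pos hd hx hy.1 hy.2).le (hμ0 y hy.1)
  rw [setIntegral_eq_zero_iff_of_nonneg_ae hn hi] at h
  have h2 : μ =ᵐ[volume.restrict (halfSpace d)] fun _ => 0 := by
    filter_upwards [h, ae_mem_halfSpace_ne (x := x)] with y h1 hy
    exact (mul_eq_zero.1 h1).resolve_left (green_pos hd hx hy.1 hy.2).ne'
  exact fun y hy => Measure.eqOn_open_of_ae_eq h2 isOpen_halfSpace hμc continuousOn_const hy

end Liminf

end HalfSpaceGreen

end

theorem mainTheorem11 (d : ℕ) (hd : 1 ≤ d)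
    (u μ : EuclideanSpace ℝ (Fin (d + 1)) → ℝ)
    (hu : ContDiffOn ℝ 2 u (HalfSpaceGreen.halfSpace d))
    (hμ : ∀ y ∈ HalfSpaceGreen.halfSpace d, -Laplacian.laplacian u y = μ y)
    (hμ0 : ∀ y ∈ HalfSpaceGreen.halfSpace d, 0 ≤ μ y) :
    -- (A) the representation at a single point
    (∀ x ∈ HalfSpaceGreen.halfSpace d, ∀ c : ℝ,
      HalfSpaceGreen.ringLiminf u x = (c : EReal) →
        HalfSpaceGreen.HasGreenRep μ x (u x) c) ∧
    -- (A) consequences when the ring limits are finite at every point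
    (∀ l : EuclideanSpace ℝ (Fin (d + 1)) → ℝ,
      (∀ x ∈ HalfSpaceGreen.halfSpace d, HalfSpaceGreen.ringLiminf u x = (l x : EReal)) →
        (⨅ x ∈ HalfSpaceGreen.halfSpace d, (u x : EReal)) =
          (⨅ x ∈ HalfSpaceGreen.halfSpace d, (l x : EReal)) ∧
        ((∀ x ∈ HalfSpaceGreen.halfSpace d, l x < u x) ∨
          ((∀ x ∈ HalfSpaceGreen.halfSpace d, u x = l x) ∧
            ∀ x ∈ HalfSpaceGreen.halfSpace d, μ x = 0)) ∧
        InnerProductSpace.HarmonicOnNhd l (HalfSpaceGreen.halfSpace d) ∧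
        (∀ c : ℝ, (∀ x ∈ HalfSpaceGreen.halfSpace d, l x = c) →
          ∀ x ∈ HalfSpaceGreen.halfSpace d, HalfSpaceGreen.HasGreenRep μ x (u x) c)) ∧
    -- (B) the ring limits are finite at every point if `u` is bounded from below
    ((∃ m : ℝ, ∀ x ∈ HalfSpaceGreen.halfSpace d, m ≤ u x) →
      ∃ l : EuclideanSpace ℝ (Fin (d + 1)) → ℝ,
        ∀ x ∈ HalfSpaceGreen.halfSpace d, HalfSpaceGreen.ringLiminf u x = (l x : EReal)) ∧
    -- (C) the harmonic part of a Riesz decomposition is the ring limit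
    (∀ H : EuclideanSpace ℝ (Fin (d + 1)) → ℝ,
      InnerProductSpace.HarmonicOnNhd H (HalfSpaceGreen.halfSpace d) →
      (∀ x ∈ HalfSpaceGreen.halfSpace d, HalfSpaceGreen.HasGreenRep μ x (u x) (H x)) →
        ∀ x ∈ HalfSpaceGreen.halfSpace d,
          HalfSpaceGreen.ringLiminf u x = (H x : EReal)) ∧
    -- (D) the equivalent ring condition with an explicit weight
    (∀ x ∈ HalfSpaceGreen.halfSpace d, ∀ c : ℝ,
      (liminf (fun R : ℝ =>
          ((HalfSpaceGreen.ringIntegral (fun y => |u y - c|) x R : ℝ) : EReal)) atTop = 0 ↔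
        liminf (fun R : ℝ =>
          ((R * ∫ y in HalfSpaceGreen.greenRing x R,
            1 / ‖x - y‖ ^ (2 * (d + 1)) * |u y - c| : ℝ) : EReal)) atTop = 0) ∧
      (liminf (fun R : ℝ =>
          ((HalfSpaceGreen.ringIntegral (fun y => |u y - c|) x R : ℝ) : EReal)) atTop = 0 →
        HalfSpaceGreen.ringLiminf u x = (c : EReal)) ∧
      (liminf (fun R : ℝ =>
          ((R * ∫ y in HalfSpaceGreen.greenRing x R,
            1 / ‖x - y‖ ^ (2 * (d + 1)) * |u y - c| : ℝ) : EReal)) atTop = 0 →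
        HalfSpaceGreen.ringLiminf u x = (c : EReal))) := by
  have hrep : ∀ x ∈ HalfSpaceGreen.halfSpace d, ∀ c : ℝ,
      HalfSpaceGreen.ringLiminf u x = (c : EReal) ↔ HalfSpaceGreen.HasGreenRep μ x (u x) c :=
    fun x hx c => HalfSpaceGreen.ringLiminf_eq_coe_iff hd hx hu hμ hμ0 c
  have hΔ : ∀ y ∈ HalfSpaceGreen.halfSpace d, Laplacian.laplacian u y ≤ 0 := fun y hy => by
    linarith [hμ y hy, hμ0 y hy]
  refine ⟨fun x hx c h => (hrep x hx c).1 h, fun l hl => ?_, fun ⟨m, hm⟩ => ?_,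
    fun H _ hH x hx => (hrep x hx _).2 (hH x hx), fun x hx c => ?_⟩
  · have hl' := fun x hx => (hrep x hx (l x)).1 (hl x hx)
    have hpot : ∀ x ∈ HalfSpaceGreen.halfSpace d,
        0 ≤ ∫ y in HalfSpaceGreen.halfSpace d, HalfSpaceGreen.green x y * μ y := by
      intro x hx
      refine integral_nonneg_of_ae ?_
      filter_upwards [HalfSpaceGreen.ae_mem_halfSpace_ne (x := x)] with y hy
      exact mul_nonneg (HalfSpaceGreen.green_pos hd hx hy.1 hy.2).le (hμ0 y hy.1)
    refine ⟨le_antisymm (le_iInf₂ fun x hx => le_of_not_gt fun hlt => ?_)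
      (iInf₂_mono fun x hx => ?_), ?_, ?_, fun c hc x hx => hc x hx ▸ hl' x hx⟩
    · -- a real number strictly between `l x` and `inf u` would be a lower bound of `l`
      obtain ⟨m, h1, h2⟩ := EReal.lt_iff_exists_real_btwn.1 hlt
      obtain ⟨c, hmc, hc⟩ := HalfSpaceGreen.exists_le_and_hasGreenRep hd hx hu hμ hμ0 (m := m)
        fun y hy => by exact_mod_cast h2.le.trans (iInf₂_le y hy)
      have e : c = l x := by linarith [hc.2, (hl' x hx).2]
      have h3 : l x < m := by exact_mod_cast h1
      linarith
    · have := hpot x hx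
      have h2 := (hl' x hx).2
      exact_mod_cast (by linarith : l x ≤ u x)
    · by_cases h : ∃ x ∈ HalfSpaceGreen.halfSpace d, u x ≤ l x
      · obtain ⟨x, hx, hle⟩ := h
        have hμz := HalfSpaceGreen.eq_zero_of_integral_green_eq_zero hd hx
          ((HalfSpaceGreen.continuousOn_laplacian HalfSpaceGreen.isOpen_halfSpace hu).neg.congr
            fun y hy => (hμ y hy).symm) hμ0 (hl' x hx).1
          (by linarith [hpot x hx, (hl' x hx).2])
        refine Or.inr ⟨fun z hz => ?_, hμz⟩
        rw [(hl' z hz).2, setIntegral_eq_zero_of_forall_eq_zero fun y hy => by simp [hμz y hy],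
          add_zero]
      · push Not at h
        exact Or.inl h
    · exact HalfSpaceGreen.harmonicOnNhd_of_greenPotential hd hu fun x hx =>
        (HalfSpaceGreen.greenRep_iff hμ _ _).1 (hl' x hx)
  · choose! l hl using fun x hx =>
      HalfSpaceGreen.exists_le_and_hasGreenRep (x := x) hd hx hu hμ hμ0 hm
    exact ⟨l, fun x hx => (hrep x hx _).2 (hl x hx).2⟩
  · have h1 : ∀ᶠ R in atTop,
        0 ≤ HalfSpaceGreen.ringIntegral (fun y => |u y - c|) x R :=
      .of_forall fun R => setIntegral_nonneg HalfSpaceGreen.measurableSet_greenRing fun y hy =>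
        mul_nonneg (HalfSpaceGreen.weight_nonneg hd hx hy) (abs_nonneg _)
    have h2 : ∀ᶠ R : ℝ in atTop, 0 ≤ R * ∫ y in HalfSpaceGreen.greenRing x R,
        1 / ‖x - y‖ ^ (2 * (d + 1)) * |u y - c| := by
      filter_upwards [eventually_ge_atTop 0] with R hR
      exact mul_nonneg hR (integral_nonneg fun y => by positivity)
    rw [HalfSpaceGreen.liminf_coe_eq_zero_iff h1, HalfSpaceGreen.liminf_coe_eq_zero_iff h2,
      ← HalfSpaceGreen.liminf_abs_iff hd hx hu c]
    exact ⟨Iff.rfl, HalfSpaceGreen.ringLiminf_eq_of_liminf_abs hd hx hu hΔ,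
      HalfSpaceGreen.ringLiminf_eq_of_liminf_abs hd hx hu hΔ⟩
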